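/- Let $\mathscr{H}$ be a complex separable Hilbert space with identity operator $I$, and let $0\le\mu\le 1$. For positive invertible bounded operators $A,B$ on $\mathscr{H}$ put $$A\nabla_\mu B=(1-\mu)A+\mu B,\qquad A\sharp_\mu B=A^{1/2}\bigl(A^{-1/2}BA^{-1/2}\bigr)^{\mu}A^{1/2},\qquad A!_\mu B=\bigl((1-\mu)A^{-1}+\mu B^{-1}\bigr)^{-1}.$$ Let $A,B$ be positive invertible operators with $A\le\frac12 I$ and $B\le\frac12 I$ such that $A-B$ is compact, and put $A'=I-A$, $B'=I-B$. Then each of the operators $$(A\sharp_\mu B)^{-\frac12}(A\nabla_\mu B)(A\sharp_\mu B)^{-\frac12},\quad (A!_\mu B)^{-\frac12}(A\sharp_\mu B)(A!_\mu B)^{-\frac12},\quad (A!_\mu B)^{-\frac12}(A\nabla_\mu B)(A!_\mu B)^{-\frac12},$$ and each of the same operators formed with $A',B'$, is of the form $I+K$ with $K$ compact and positive, so that its eigenvalues can be arranged in decreasing order, repeated according to multiplicity. Let $\lambda_j$ $(j=1,2,\ldots)$ denote the $j$-th eigenvalue in this order, that is, the largest eigenvalue $t$ such that at least $j$ eigenvalues,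 counted with multiplicity, are $\ge t$ (with $\lambda_j=0$ for $j>\dim\mathscr{H}$ if $\mathscr{H}$ is finite-dimensional). Then for all $j=1,2,\ldots$, $$\lambda_j\bigl((A'\sharp_\mu B')^{-\frac12}(A'\nabla_\mu B')(A'\sharp_\mu B')^{-\frac12}\bigr)\le\lambda_j\bigl((A\sharp_\mu B)^{-\frac12}(A\nabla_\mu B)(A\sharp_\mu B)^{-\frac12}\bigr),$$ $$\lambda_j\bigl((A'!_\mu B')^{-\frac12}(A'\sharp_\mu B')(A'!_\mu B')^{-\frac12}\bigr)\le\lambda_j\bigl((A!_\mu B)^{-\frac12}(A\sharp_\mu B)(A!_\mu B)^{-\frac12}\bigr),$$ $$\lambda_j\bigl((A'!_\mu B')^{-\frac12}(A'\nabla_\mu B')(A'!_\mu B')^{-\frac12}\bigr)\le\lambda_j\bigl((A!_\mu B)^{-\frac12}(A\nabla_\mu B)(A!_\mu B)^{-\frac12}\bigr).$$ Moreover, when $0<\mu<1$, for each of these three systems of inequalities, equality holds for all $j$ if and only if $A=B$. -/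

import Mathlib

noncomputable section

namespace KyFan

variable {H : Type*} [NormedAddCommGroup H] [InnerProductSpace ℂ H] [CompleteSpace H]

/-- The `μ`-weighted arithmetic mean `A ∇_μ B = (1 - μ) A + μ B`. -/
def arithMean (μ : ℝ) (A B : H →L[ℂ] H) : H →L[ℂ] H :=
  (1 - μ) • A + μ • B

/-- The `μ`-weighted geometric mean `A ♯_μ B = A^{1/2} (A^{-1/2} B A^{-1/2})^μ A^{1/2}` of positive
invertible operators; the real powers are those of the continuous functional calculus. -/
def geomMean (μ : ℝ) (A B : H →L[ℂ] H) : H →L[ℂ] H :=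
  A ^ (1 / 2 : ℝ) * (A ^ (-(1 / 2) : ℝ) * B * A ^ (-(1 / 2) : ℝ)) ^ μ * A ^ (1 / 2 : ℝ)

/-- The `μ`-weighted harmonic mean `A !_μ B = ((1 - μ) A⁻¹ + μ B⁻¹)⁻¹` of positive invertible
operators. -/
def harmMean (μ : ℝ) (A B : H →L[ℂ] H) : H →L[ℂ] H :=
  Ring.inverse ((1 - μ) • Ring.inverse A + μ • Ring.inverse B)

/-- The ratio operator `X^{-1/2} Y X^{-1/2}`, for `X` positive and invertible. -/
def ratio (X Y : H →L[ℂ] H) : H →L[ℂ] H :=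
  X ^ (-(1 / 2) : ℝ) * Y * X ^ (-(1 / 2) : ℝ)

/-- The operator `T` has the form `T = I + K` with `K` compact and positive. -/
def IsOneAddCompactPos (T : H →L[ℂ] H) : Prop :=
  0 ≤ T - 1 ∧ IsCompactOperator (T - 1 : H →L[ℂ] H)

/-- The number of eigenvalues of `T` in `[t, ∞)`, counted with multiplicity: the dimension of the
sum of the eigenspaces `ker (T - s)`, `s ≥ t` (this sum is direct, so that its dimension is the sum
of the multiplicities). It may be infinite. -/
def eigenvalueCount (T : H →L[ℂ] H) (t : ℝ) : Cardinal :=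
  Module.rank ℂ
    (⨆ s ∈ Set.Ici t, Module.End.eigenspace (T : H →ₗ[ℂ] H) (s : ℂ) : Submodule ℂ H)

/-- `eigenvalue T j`, for `j = 1, 2, …`, is the `j`-th eigenvalue `λ_j(T)` when the eigenvalues of
`T` are arranged in decreasing order and repeated according to their multiplicity: the largest
eigenvalue `t` such that at least `j` eigenvalues, counted with multiplicity, are `≥ t`.
On a space of finite dimension `n` the list has only `n` terms for a self-adjoint `T`, and
`eigenvalue T j = 0` for `j > n`. -/
def eigenvalue (T : H →L[ℂ] H) (j : ℕ) : ℝ :=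
  sSup {t : ℝ | Module.End.HasEigenvalue (T : H →ₗ[ℂ] H) (t : ℂ) ∧
    (j : Cardinal) ≤ eigenvalueCount T t}

end KyFan

end

/-!
The proof reads off the eigenvalues of all ratio operators from the operator pencil `(A, B)`, that
is, from the solutions of `B v = x A v`. If `B v = x A v` with `x > 0`, then each of the three means
maps `v` to a scalar multiple of `A v`, the scalar being the corresponding mean of `1` and `x`
(`arithMean_apply`, `geomMean_apply`, `harmMean_apply`). Hence `v` yields an eigenvector of the
ratio operator with eigenvalue `f x`, where `f` is the quotient of the two scalar means:
`f x = (1 - μ + μ x) x ^ (-μ)` for arithmetic over geometric mean, `f x⁻¹` for geometric over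
harmonic mean, and `f x * f x⁻¹` for arithmetic over harmonic mean. Since `A - B` is compact, these
eigenvectors are total by the spectral theorem. So the ratio operator is `≥ 1`, and for `t > 1` it
has as many eigenvalues `≥ t` as the pencil has eigenvalues `x` with `f x ≥ t`
(`IsMeanPair.eigenvalueCount_eq`). Counting functions at `t > 1` determine the sequence of
eigenvalues (`IsOneAddCompactPos.le_eigenvalue_iff`, `IsOneAddCompactPos.one_le_eigenvalue`).

It remains to compare the pencils `(A, B)` and `(A', B') = (1 - A, 1 - B)`. Here `A ≤ A'`, `B ≤ B'`
and `B' - A' = A - B`. A generalized Rayleigh quotient of the second pencil that is `≥ 1 + q`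
therefore forces that of the first to be `≤ 1 - q`, so that the first pencil has at least as many
eigenvalues `≤ 1 - q` as the second has eigenvalues `≥ 1 + q` (`rank_pencilSpan_Ici_le`). As `f`
decreases on `(0, 1]`, increases on `[1, ∞)` and satisfies `f (1 + s) ≤ f (1 - s)`, this bounds the
eigenvalues `f y > 1` with `y > 1` for the second pencil by eigenvalues `f x` with `x < 1` for the
first. Interchanging `A` and `B` replaces `x` by `x⁻¹` and `f` by `x ↦ f x⁻¹`, which has the same
properties, and this takes care of the eigenvalues `y < 1` (`eigenvalue_ratio_le`).

For `0 < μ < 1` the inequality `f (1 + s) < f (1 - s)` is strict and `f > 1` off the point `1`. If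
`A ≠ B`, the largest eigenvalue of the second ratio operator is some `f y > 1`, and the comparison
gives an eigenvalue `f x > f y` of the first, so that already the first eigenvalues differ
(`eq_of_eigenvalue_one_eq`).
-/

noncomputable section

namespace KyFan

open Set Module

/-! ### Eigenvectors of an operator pencil -/

section

variable {H : Type*} [NormedAddCommGroup H] [InnerProductSpace ℂ H]

/-- The sum of the eigenspaces `ker (B - s A)`, `s ∈ S`, of the operator pencil `(A, B)`. For
`A = 1` this is the sum of the eigenspaces of `B` at the points of `S`. -/
def pencilSpan (A B : H →L[ℂ] H) (S : Set ℝ) : Submodule ℂ H :=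
  ⨆ s ∈ S, LinearMap.ker ((B - (s : ℂ) • A : H →L[ℂ] H) : H →ₗ[ℂ] H)

theorem mem_ker_pencil {A B : H →L[ℂ] H} {s : ℝ} {v : H} :
    v ∈ LinearMap.ker ((B - (s : ℂ) • A : H →L[ℂ] H) : H →ₗ[ℂ] H) ↔ B v = (s : ℂ) • A v := by
  simp [sub_eq_zero]

theorem mem_pencilSpan {A B : H →L[ℂ] H} {S : Set ℝ} {s : ℝ} (hs : s ∈ S) {v : H}
    (h : B v = (s : ℂ) • A v) : v ∈ pencilSpan A B S :=
  Submodule.mem_iSup_of_mem s (Submodule.mem_iSup_of_mem hs (mem_ker_pencil.2 h))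

theorem pencilSpan_le {A B : H →L[ℂ] H} {S : Set ℝ} {W : Submodule ℂ H}
    (h : ∀ s ∈ S, ∀ v, B v = (s : ℂ) • A v → v ∈ W) : pencilSpan A B S ≤ W :=
  iSup₂_le fun s hs v hv => h s hs v (mem_ker_pencil.1 hv)

theorem pencilSpan_mono (A B : H →L[ℂ] H) {S S' : Set ℝ} (h : S ⊆ S') :
    pencilSpan A B S ≤ pencilSpan A B S' :=
  pencilSpan_le fun _ hs _ hv => mem_pencilSpan (h hs) hv

theorem pencilSpan_union (A B : H →L[ℂ] H) (S S' : Set ℝ) :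
    pencilSpan A B (S ∪ S') = pencilSpan A B S ⊔ pencilSpan A B S' := by
  simp only [pencilSpan, iSup_union]

theorem eigenspace_eq_ker_pencil (T : H →L[ℂ] H) (s : ℝ) :
    End.eigenspace (T : H →ₗ[ℂ] H) (s : ℂ) =
      LinearMap.ker ((T - (s : ℂ) • 1 : H →L[ℂ] H) : H →ₗ[ℂ] H) := by
  ext v
  rw [mem_ker_pencil, End.mem_eigenspace_iff]
  rfl

theorem eigenvalueCount_eq_rank_pencilSpan (T : H →L[ℂ] H) (t : ℝ) :
    eigenvalueCount T t = Module.rank ℂ (pencilSpan 1 T (Ici t)) := by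
  have h : (⨆ s ∈ Ici t, End.eigenspace (T : H →ₗ[ℂ] H) (s : ℂ)) = pencilSpan 1 T (Ici t) :=
    iSup_congr fun s => iSup_congr fun _ => eigenspace_eq_ker_pencil T s
  rw [eigenvalueCount, h]

theorem hasEigenvalue_iff_exists (T : H →L[ℂ] H) (s : ℝ) :
    End.HasEigenvalue (T : H →ₗ[ℂ] H) (s : ℂ) ↔ ∃ v ≠ 0, T v = (s : ℂ) • v := by
  rw [End.hasEigenvalue_iff, Submodule.ne_bot_iff]
  simp only [End.mem_eigenspace_iff, and_comm]
  rfl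

theorem exists_of_pencilSpan_ne_bot {A B : H →L[ℂ] H} {S : Set ℝ} (h : pencilSpan A B S ≠ ⊥) :
    ∃ s ∈ S, ∃ v ≠ 0, B v = (s : ℂ) • A v := by
  contrapose! h
  rw [eq_bot_iff]
  refine pencilSpan_le fun s hs v hv => ?_
  by_contra h0
  exact h s hs v h0 hv

theorem apply_eq_inv_smul {A B : H →L[ℂ] H} {x : ℝ} (hx : x ≠ 0) {v : H} (h : B v = (x : ℂ) • A v) :
    A v = ((x⁻¹ : ℝ) : ℂ) • B v := by
  have h0 : (x : ℂ) ≠ 0 := by exact_mod_cast hx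
  rw [h, smul_smul, Complex.ofReal_inv, inv_mul_cancel₀ h0, one_smul]

/-- Interchanging the two operators of a pencil inverts its eigenvalues and keeps its
eigenvectors. -/
theorem pencilSpan_swap_le {A B : H →L[ℂ] H} {S S' : Set ℝ}
    (h : ∀ s ∈ S, s ≠ 0 ∧ s⁻¹ ∈ S') : pencilSpan A B S ≤ pencilSpan B A S' := by
  exact pencilSpan_le fun s hs v hv => mem_pencilSpan (h s hs).2 (apply_eq_inv_smul (h s hs).1 hv)

/-- Passing from the pencil `(A, B)` to the pencil `(R * A * R, R * B * R)`, `R` invertible. -/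
theorem map_pencilSpan_conj {A B R L : H →L[ℂ] H} (hRL : R * L = 1) (hLR : L * R = 1)
    (S : Set ℝ) :
    (pencilSpan (R * A * R) (R * B * R) S).map (R : H →ₗ[ℂ] H) = pencilSpan A B S := by
  have h1 : ∀ v, R (L v) = v := fun v => congr($hRL v)
  have h2 : ∀ v, L (R v) = v := fun v => congr($hLR v)
  apply le_antisymm
  · rw [Submodule.map_le_iff_le_comap]
    refine pencilSpan_le fun s hs v hv => mem_pencilSpan hs ?_
    have := congr(L $hv)
    simpa [h2] using this
  · refine pencilSpan_le fun s hs v hv => ⟨L v, mem_pencilSpan hs ?_, h1 v⟩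
    simp [h1, hv]

theorem rank_map_of_leftInverse {R L : H →L[ℂ] H} (hLR : L * R = 1) (V : Submodule ℂ H) :
    Module.rank ℂ (V.map (R : H →ₗ[ℂ] H)) = Module.rank ℂ V := by
  have h2 : ∀ v, L (R v) = v := fun v => congr($hLR v)
  exact (LinearEquiv.rank_eq (Submodule.equivMapOfInjective (R : H →ₗ[ℂ] H)
    (Function.LeftInverse.injective h2) V)).symm

theorem isCompactOperator_mul_mul {K : H →L[ℂ] H} (hK : IsCompactOperator K) (S T : H →L[ℂ] H) :
    IsCompactOperator (S * K * T : H →L[ℂ] H) :=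
  (hK.clm_comp S).comp_clm T

section Symmetric

variable [CompleteSpace H] {A B : H →L[ℂ] H}

theorem inner_apply_left (hA : IsSelfAdjoint A) (v w : H) :
    inner ℂ (A v) w = inner ℂ v (A w) := hA.isSymmetric v w

/-- Eigenvectors of a pencil of self-adjoint operators `(A, B)` at different eigenvalues are
orthogonal with respect to `A`. -/
theorem inner_eq_zero_of_mem_pencilSpan (hA : IsSelfAdjoint A) (hB : IsSelfAdjoint B)
    {S S' : Set ℝ} (hS : Disjoint S S') {v w : H} (hv : v ∈ pencilSpan A B S)
    (hw : w ∈ pencilSpan A B S') : inner ℂ (A v) w = 0 := by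
  have key : ∀ s ∈ S, ∀ s' ∈ S', ∀ v w, B v = (s : ℂ) • A v → B w = (s' : ℂ) • A w →
      inner ℂ (A v) w = 0 := by
    intro s hs s' hs' v w hv hw
    have hne : s - s' ≠ 0 := sub_ne_zero.2 fun h => Set.disjoint_left.1 hS hs (h ▸ hs')
    have h := inner_apply_left hB v w
    rw [hv, hw, inner_smul_left, inner_smul_right, ← inner_apply_left hA, Complex.conj_ofReal] at h
    have h' : ((s - s' : ℝ) : ℂ) * inner ℂ (A v) w = 0 := by
      push_cast
      rw [sub_mul, h, sub_self]
    exact (mul_eq_zero.1 h').resolve_left (by exact_mod_cast hne)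
  have h1 : pencilSpan A B S' ≤ ((pencilSpan A B S).map (A : H →ₗ[ℂ] H))ᗮ := by
    refine pencilSpan_le fun s' hs' w hw => ?_
    rw [Submodule.mem_orthogonal]
    rintro _ ⟨v, hv, rfl⟩
    have h2 : pencilSpan A B S ≤ (ℂ ∙ (A w))ᗮ := by
      refine pencilSpan_le fun s hs v hv => ?_
      rw [Submodule.mem_orthogonal_singleton_iff_inner_left, ← inner_apply_left hA]
      exact key s hs s' hs' v w hv hw
    have h3 := h2 hv
    rw [Submodule.mem_orthogonal_singleton_iff_inner_left, ← inner_apply_left hA] at h3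
    exact h3
  exact (Submodule.mem_orthogonal _ _).1 (h1 hw) _ ⟨v, hv, rfl⟩

/-- On the span of the eigenvectors with eigenvalues `≥ r`, the quadratic form of `B` is at
least `r` times that of `A`. -/
theorem le_inner_of_mem_pencilSpan (hA : 0 ≤ A) (hB : IsSelfAdjoint B) {S : Set ℝ} {r : ℝ}
    (hS : ∀ s ∈ S, r ≤ s) {v : H} (hv : v ∈ pencilSpan A B S) :
    r * (inner ℂ (A v) v).re ≤ (inner ℂ (B v) v).re := by
  have hA' : IsSelfAdjoint A := .of_nonneg hA
  have hpos : ∀ v, 0 ≤ (inner ℂ (A v) v).re := fun v =>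
    ((ContinuousLinearMap.nonneg_iff_isPositive A).1 hA).re_inner_nonneg_left v
  rw [pencilSpan, iSup_subtype', Submodule.mem_iSup_iff_exists_finsupp] at hv
  obtain ⟨f, hf, rfl⟩ := hv
  simp only [mem_ker_pencil] at hf
  have horth : ∀ i j, i ≠ j → inner ℂ (A (f i)) (f j) = 0 := fun i j hij =>
    inner_eq_zero_of_mem_pencilSpan hA' hB (S := {(i : ℝ)}) (S' := {(j : ℝ)})
      (by simpa [Subtype.ext_iff] using hij)
      (mem_pencilSpan (mem_singleton _) (hf i)) (mem_pencilSpan (mem_singleton _) (hf j))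
  have e1 : inner ℂ (A (f.sum fun _ x => x)) (f.sum fun _ x => x) =
      ∑ i ∈ f.support, inner ℂ (A (f i)) (f i) := by
    simp only [Finsupp.sum, map_sum, sum_inner, inner_sum]
    refine Finset.sum_congr rfl fun i hi => ?_
    exact Finset.sum_eq_single i (fun j _ hj => horth j i hj) fun h => absurd hi h
  have e2 : inner ℂ (B (f.sum fun _ x => x)) (f.sum fun _ x => x) =
      ∑ i ∈ f.support, ((i : ℝ) : ℂ) * inner ℂ (A (f i)) (f i) := by
    simp only [Finsupp.sum, map_sum, sum_inner, inner_sum]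
    refine Finset.sum_congr rfl fun i hi => ?_
    simp only [hf, inner_smul_left, Complex.conj_ofReal]
    exact Finset.sum_eq_single i (fun j _ hj => by rw [horth j i hj, mul_zero])
      fun h => absurd hi h
  rw [e1, e2, Complex.re_sum, Complex.re_sum, Finset.mul_sum]
  refine Finset.sum_le_sum fun i _ => ?_
  rw [Complex.re_ofReal_mul]
  exact mul_le_mul_of_nonneg_right (hS i i.2) (hpos _)

/-- A subspace on which a compact operator is coercive is finite-dimensional. -/
theorem finiteDimensional_of_coercive {K : H →L[ℂ] H} (hK : IsCompactOperator K)
    (V : Submodule ℂ H) {c : ℝ} (hc : 0 < c)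
    (h : ∀ v ∈ V, c * ‖v‖ ^ 2 ≤ (inner ℂ (K v) v).re) : FiniteDimensional ℂ V := by
  have hcl : ∀ v ∈ V.topologicalClosure, c * ‖v‖ ^ 2 ≤ (inner ℂ (K v) v).re := by
    have : IsClosed {v : H | c * ‖v‖ ^ 2 ≤ (inner ℂ (K v) v).re} :=
      isClosed_le (by fun_prop) (by fun_prop)
    exact fun v hv => closure_minimal (s := (V : Set H)) h this hv
  have hb : ∀ v ∈ V.topologicalClosure, c * ‖v‖ ≤ ‖K v‖ := by
    intro v hv
    rcases eq_or_ne v 0 with rfl | h0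
    · simp
    have h1 := (hcl v hv).trans ((Complex.re_le_norm _).trans (norm_inner_le_norm _ _))
    have : 0 < ‖v‖ := norm_pos_iff.2 h0
    nlinarith
  -- `K` is a closed embedding on the closure of `V`, whose unit ball is therefore compact.
  obtain ⟨C, hC, hKC⟩ := hK.image_closedBall_subset_compact (𝕜₁ := ℂ) (𝕜₂ := ℂ)
    (f := (K : H →ₗ[ℂ] H)) 1
  let g : V.topologicalClosure →L[ℂ] H := K ∘L V.topologicalClosure.subtypeL
  have hanti : AntilipschitzWith (Real.toNNReal c⁻¹) g := by
    refine g.antilipschitz_of_bound fun v => ?_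
    rw [Real.coe_toNNReal _ (by positivity), inv_mul_eq_div, le_div_iff₀ hc, mul_comm]
    exact hb v v.2
  have hemb : Topology.IsClosedEmbedding g :=
    hanti.isClosedEmbedding g.lipschitz.uniformContinuous
  have hcomp : IsCompact (Metric.closedBall (0 : V.topologicalClosure) 1) := by
    refine (hemb.isCompact_preimage hC).of_isClosed_subset Metric.isClosed_closedBall ?_
    intro v hv
    exact hKC ⟨v, by simpa using hv, rfl⟩
  have : FiniteDimensional ℂ V.topologicalClosure :=
    FiniteDimensional.of_isCompact_closedBall ℂ one_pos hcomp
  exact Submodule.finiteDimensional_of_le V.le_topologicalClosure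

/-- The eigenvectors of a self-adjoint compact perturbation of the identity span a dense
subspace. -/
theorem orthogonal_pencilSpan_one_univ {X : H →L[ℂ] H} (hX : IsSelfAdjoint X)
    (hc : IsCompactOperator (X - 1 : H →L[ℂ] H)) : (pencilSpan 1 X univ)ᗮ = ⊥ := by
  have hZ : IsSelfAdjoint (X - 1) := hX.sub (.one _)
  have h := ContinuousLinearMap.orthogonalComplement_iSup_eigenspaces_eq_bot hc hZ.isSymmetric
  rw [eq_bot_iff, ← h]
  refine Submodule.orthogonal_le (iSup_le fun μ v hv => ?_)
  rcases eq_or_ne v 0 with rfl | h0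
  · exact zero_mem _
  have hreal := hZ.isSymmetric.conj_eigenvalue_eq_self
    (End.hasEigenvalue_of_hasEigenvector ⟨hv, h0⟩)
  rw [Complex.conj_eq_iff_re] at hreal
  rw [End.mem_eigenspace_iff] at hv
  refine mem_pencilSpan (mem_univ (μ.re + 1)) ?_
  have hv' : X v - v = μ • v := hv
  rw [Complex.ofReal_add, hreal, ← sub_add_cancel (X v) v, hv']
  simp [add_smul]

/-- A nonzero vector orthogonal to all eigenvectors with eigenvalues `≤ r` has Rayleigh quotient
`> r`. -/
theorem lt_inner_of_orthogonal_one {X : H →L[ℂ] H} (hX : IsSelfAdjoint X)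
    (hc : IsCompactOperator (X - 1 : H →L[ℂ] H)) {r : ℝ} {u : H}
    (hu : u ∈ (pencilSpan 1 X (Iic r))ᗮ) (h0 : u ≠ 0) :
    r * (inner ℂ u u).re < (inner ℂ (X u) u).re := by
  set M := (pencilSpan 1 X (Iic r))ᗮ with hM
  have hMcl : M ≤ (pencilSpan 1 X (Ioi r)).topologicalClosure := by
    set N := (pencilSpan 1 X (Ioi r)).topologicalClosure with hN
    have hNM : N ≤ M := by
      refine Submodule.topologicalClosure_minimal _ ?_ (Submodule.isClosed_orthogonal _)
      intro w hw
      rw [hM, Submodule.mem_orthogonal]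
      intro v hv
      have hd : Disjoint (Iic r) (Ioi r) := by simp
      exact inner_eq_zero_of_mem_pencilSpan (A := 1) (.one _) hX hd hv hw
    have h := Submodule.sup_orthogonal_inf_of_hasOrthogonalProjection hNM
    have h2 : Nᗮ ⊓ M = ⊥ := by
      rw [hN, Submodule.orthogonal_closure, hM, Submodule.inf_orthogonal, ← pencilSpan_union,
        ← orthogonal_pencilSpan_one_univ hX hc]
      congr 2
      ext x
      simp
    rw [h2, sup_bot_eq] at h
    exact h.ge
  have hform : ∀ v ∈ M, 0 ≤ (inner ℂ (X v - (r : ℂ) • v) v).re := by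
    intro v hv
    have hcl : IsClosed {v : H | 0 ≤ (inner ℂ (X v - (r : ℂ) • v) v).re} :=
      isClosed_le (by fun_prop) (by fun_prop)
    refine closure_minimal (s := (pencilSpan 1 X (Ioi r) : Set H)) ?_ hcl (hMcl hv)
    intro w hw
    have := le_inner_of_mem_pencilSpan (A := 1) zero_le_one hX (r := r)
      (fun s hs => le_of_lt hs) hw
    simpa [inner_sub_left, inner_smul_left] using this
  by_contra! hle
  set z := X u - (r : ℂ) • u with hz
  have hzM : z ∈ M := by
    have : X u ∈ M := by
      rw [hM]
      have hle : pencilSpan 1 X (Iic r) ≤ (ℂ ∙ (X u))ᗮ := by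
        refine pencilSpan_le fun s hs e he => ?_
        rw [Submodule.mem_orthogonal_singleton_iff_inner_left, ← inner_apply_left hX, he,
          inner_smul_left]
        have := (Submodule.mem_orthogonal _ _).1 hu e (mem_pencilSpan hs he)
        simp [this]
      rw [Submodule.mem_orthogonal]
      intro e he
      exact (Submodule.mem_orthogonal_singleton_iff_inner_left).1 (hle he)
    exact M.sub_mem this (M.smul_mem _ hu)
  have hzu : (inner ℂ z u).re ≤ 0 := by
    simpa [hz, inner_sub_left, inner_smul_left] using hle
  -- The form of `X - r` is nonnegative on `M` and vanishes at `u`, so its first variation at `u`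
  -- in the direction `z = (X - r) u ∈ M` is zero.
  have hzz : z = 0 := by
    have hquad : ∀ ε : ℝ, 0 ≤ 2 * ε * ‖z‖ ^ 2 + ε ^ 2 * (inner ℂ (X z - (r : ℂ) • z) z).re := by
      intro ε
      have h1 := hform (u + (ε : ℂ) • z) (M.add_mem hu (M.smul_mem _ hzM))
      have e1 : X (u + (ε : ℂ) • z) - (r : ℂ) • (u + (ε : ℂ) • z) =
          z + (ε : ℂ) • (X z - (r : ℂ) • z) := by
        have h2 : ∀ w, X (u + (ε : ℂ) • w) - (r : ℂ) • (u + (ε : ℂ) • w) =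
            (X u - (r : ℂ) • u) + (ε : ℂ) • (X w - (r : ℂ) • w) := by
          intro w
          rw [map_add, map_smul]
          module
        exact h2 z
      have e2 : inner ℂ (X z - (r : ℂ) • z) u = inner ℂ z z := by
        rw [inner_sub_left, inner_apply_left hX, inner_smul_left, Complex.conj_ofReal]
        rw [← inner_smul_right, ← inner_sub_right]
      have e3 : (inner ℂ z z).re = ‖z‖ ^ 2 := by
        exact_mod_cast inner_self_eq_norm_sq (𝕜 := ℂ) z
      rw [e1, inner_add_left, inner_add_right, inner_add_right, inner_smul_left, inner_smul_left,
        inner_smul_right, inner_smul_right, e2, Complex.conj_ofReal] at h1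
      simp only [Complex.add_re, Complex.re_ofReal_mul, e3] at h1
      nlinarith
    set d := (inner ℂ (X z - (r : ℂ) • z) z).re
    by_contra hne
    have hzpos : 0 < ‖z‖ ^ 2 := by positivity
    have hd : 0 ≤ d := hform z hzM
    have h1 := hquad (-(‖z‖ ^ 2 / (d + 1)))
    have h2 : -(‖z‖ ^ 2 / (d + 1)) * 2 * ‖z‖ ^ 2 + (‖z‖ ^ 2 / (d + 1)) ^ 2 * d < 0 := by
      have : (‖z‖ ^ 2 / (d + 1)) * (d + 1) = ‖z‖ ^ 2 := by field_simp
      have hp : 0 < ‖z‖ ^ 2 / (d + 1) := by positivity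
      nlinarith
    linarith
  have hmem : u ∈ pencilSpan 1 X (Iic r) :=
    mem_pencilSpan (s := r) (by simp) (by simpa [hz, sub_eq_zero] using hzz)
  exact h0 (inner_self_eq_zero.1 ((Submodule.mem_orthogonal _ _).1 hu u hmem))

end Symmetric

end

/-! ### Pencils of positive invertible operators with compact difference -/

section

variable {H : Type*} [NormedAddCommGroup H] [InnerProductSpace ℂ H] [CompleteSpace H]
  {A B : H →L[ℂ] H}

theorem rpow_half_mul_self (hA : IsStrictlyPositive A) :
    A ^ (1 / 2 : ℝ) * A ^ (1 / 2 : ℝ) = A := by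
  rw [← CFC.rpow_add hA.isUnit]
  norm_num
  exact CFC.rpow_one A hA.nonneg

theorem rpow_half_mul_rpow_neg_half (hA : IsStrictlyPositive A) :
    A ^ (1 / 2 : ℝ) * A ^ (-(1 / 2) : ℝ) = 1 := CFC.rpow_mul_rpow_neg _ hA

theorem rpow_neg_half_mul_rpow_half (hA : IsStrictlyPositive A) :
    A ^ (-(1 / 2) : ℝ) * A ^ (1 / 2 : ℝ) = 1 := CFC.rpow_neg_mul_rpow _ hA

theorem isSelfAdjoint_rpow (A : H →L[ℂ] H) (x : ℝ) : IsSelfAdjoint (A ^ x) :=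
  .of_nonneg CFC.rpow_nonneg

theorem ratio_self (hA : IsStrictlyPositive A) : ratio A A = 1 := by
  rw [ratio]
  nth_rw 2 [← rpow_half_mul_self hA]
  rw [← mul_assoc, rpow_neg_half_mul_rpow_half hA, one_mul, rpow_half_mul_rpow_neg_half hA]

theorem isSelfAdjoint_ratio (A : H →L[ℂ] H) (hB : IsSelfAdjoint B) :
    IsSelfAdjoint (ratio A B) := by
  have h := isSelfAdjoint_rpow A (-(1 / 2))
  rw [ratio, IsSelfAdjoint, star_mul, star_mul, h.star_eq, hB.star_eq, mul_assoc]

theorem isStrictlyPositive_ratio (hA : IsStrictlyPositive A) (hB : IsStrictlyPositive B) :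
    IsStrictlyPositive (ratio A B) :=
  IsStrictlyPositive.conjugate_of_isUnit_of_isSelfAdjoint _ _
    (hA.rpow A _).isUnit (isSelfAdjoint_rpow _ _) hB

theorem isCompactOperator_ratio_sub_one (hA : IsStrictlyPositive A)
    (hc : IsCompactOperator (B - A : H →L[ℂ] H)) :
    IsCompactOperator (ratio A B - 1 : H →L[ℂ] H) := by
  have h := isCompactOperator_mul_mul hc (A ^ (-(1 / 2) : ℝ)) (A ^ (-(1 / 2) : ℝ))
  rw [mul_sub, sub_mul] at h
  have h1 := ratio_self hA
  rw [ratio] at h1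
  rw [h1] at h
  exact h

theorem map_pencilSpan_ratio (hA : IsStrictlyPositive A) (B : H →L[ℂ] H) (S : Set ℝ) :
    (pencilSpan 1 (ratio A B) S).map ((A ^ (-(1 / 2) : ℝ) : H →L[ℂ] H) : H →ₗ[ℂ] H) =
      pencilSpan A B S := by
  have h := map_pencilSpan_conj (A := A) (B := B) (rpow_neg_half_mul_rpow_half hA)
    (rpow_half_mul_rpow_neg_half hA) S
  have h1 := ratio_self hA
  rw [ratio] at h1
  rw [h1] at h
  exact h

theorem exists_pos_le_inner (hA : IsStrictlyPositive A) :
    ∃ c > 0, ∀ v, c * ‖v‖ ^ 2 ≤ (inner ℂ (A v) v).re := by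
  set R := A ^ (-(1 / 2) : ℝ)
  set S := A ^ (1 / 2 : ℝ)
  refine ⟨((‖R‖ + 1) ^ 2)⁻¹, by positivity, fun v => ?_⟩
  have h1 : R (S v) = v := congr($(rpow_neg_half_mul_rpow_half hA) v)
  have h2 : S (S v) = A v := congr($(rpow_half_mul_self hA) v)
  have h3 : (inner ℂ (A v) v).re = ‖S v‖ ^ 2 := by
    rw [← h2, inner_apply_left (isSelfAdjoint_rpow A _)]
    exact_mod_cast inner_self_eq_norm_sq (𝕜 := ℂ) (S v)
  rw [h3, inv_mul_le_iff₀ (by positivity), ← mul_pow]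
  gcongr
  calc ‖v‖ = ‖R (S v)‖ := by rw [h1]
    _ ≤ ‖R‖ * ‖S v‖ := R.le_opNorm _
    _ ≤ _ := by gcongr; linarith

theorem inner_apply_self_pos (hA : IsStrictlyPositive A) {v : H} (hv : v ≠ 0) :
    0 < (inner ℂ (A v) v).re := by
  obtain ⟨c, hc, h⟩ := exists_pos_le_inner hA
  have : 0 < ‖v‖ := norm_pos_iff.2 hv
  exact lt_of_lt_of_le (by positivity) (h v)

theorem pencil_eigenvalue_pos (hA : IsStrictlyPositive A) (hB : IsStrictlyPositive B) {s : ℝ}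
    {v : H} (hv : v ≠ 0) (h : B v = (s : ℂ) • A v) : 0 < s := by
  have h1 := inner_apply_self_pos hB hv
  rw [h, inner_smul_left, Complex.conj_ofReal, Complex.re_ofReal_mul] at h1
  exact (pos_iff_pos_of_mul_pos h1).2 (inner_apply_self_pos hA hv)

theorem pencilSpan_le_of_pos (hA : IsStrictlyPositive A) (hB : IsStrictlyPositive B)
    {S S' : Set ℝ} (h : ∀ s ∈ S, 0 < s → s ∈ S') : pencilSpan A B S ≤ pencilSpan A B S' := by
  refine pencilSpan_le fun s hs v hv => ?_
  rcases eq_or_ne v 0 with rfl | h0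
  · exact zero_mem _
  · exact mem_pencilSpan (h s hs (pencil_eigenvalue_pos hA hB h0 hv)) hv

theorem orthogonal_pencilSpan_univ (hA : IsStrictlyPositive A) (hB : IsSelfAdjoint B)
    (hc : IsCompactOperator (B - A : H →L[ℂ] H)) : (pencilSpan A B univ)ᗮ = ⊥ := by
  rw [Submodule.eq_bot_iff]
  intro v hv
  have h1 : (A ^ (-(1 / 2) : ℝ)) v ∈ (pencilSpan 1 (ratio A B) univ)ᗮ := by
    rw [Submodule.mem_orthogonal]
    intro e he
    rw [← map_pencilSpan_ratio hA, Submodule.mem_orthogonal] at hv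
    rw [← inner_apply_left (isSelfAdjoint_rpow A _)]
    exact hv _ ⟨e, he, rfl⟩
  rw [orthogonal_pencilSpan_one_univ (isSelfAdjoint_ratio A hB)
    (isCompactOperator_ratio_sub_one hA hc), Submodule.mem_bot] at h1
  have h2 : (A ^ (1 / 2 : ℝ)) ((A ^ (-(1 / 2) : ℝ)) v) = v :=
    congr($(rpow_half_mul_rpow_neg_half hA) v)
  rw [← h2, h1, map_zero]

/-- A nonzero vector `A`-orthogonal to all eigenvectors of the pencil `(A, B)` with eigenvalues
`≤ r` has generalized Rayleigh quotient `> r`. -/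
theorem lt_inner_of_forall_inner_eq_zero (hA : IsStrictlyPositive A) (hB : IsSelfAdjoint B)
    (hc : IsCompactOperator (B - A : H →L[ℂ] H)) {r : ℝ} {u : H} (h0 : u ≠ 0)
    (hu : ∀ e ∈ pencilSpan A B (Iic r), inner ℂ e (A u) = 0) :
    r * (inner ℂ (A u) u).re < (inner ℂ (B u) u).re := by
  set R := A ^ (-(1 / 2) : ℝ)
  set S := A ^ (1 / 2 : ℝ)
  have hRsa : IsSelfAdjoint R := isSelfAdjoint_rpow A _
  have hSsa : IsSelfAdjoint S := isSelfAdjoint_rpow A _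
  have h1 : ∀ v, R (S v) = v := fun v => congr($(rpow_neg_half_mul_rpow_half hA) v)
  have h2 : ∀ v, S (S v) = A v := fun v => congr($(rpow_half_mul_self hA) v)
  have hmem : S u ∈ (pencilSpan 1 (ratio A B) (Iic r))ᗮ := by
    rw [Submodule.mem_orthogonal]
    intro e he
    have h3 : R e ∈ pencilSpan A B (Iic r) := by
      rw [← map_pencilSpan_ratio hA]
      exact ⟨e, he, rfl⟩
    have h4 := hu _ h3
    rwa [inner_apply_left hRsa, ← h2, h1] at h4
  have hne : S u ≠ 0 := fun h => h0 (by rw [← h1 u, h, map_zero])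
  have h := lt_inner_of_orthogonal_one (isSelfAdjoint_ratio A hB)
    (isCompactOperator_ratio_sub_one hA hc) hmem hne
  have e1 : ratio A B (S u) = R (B (R (S u))) := rfl
  rwa [e1, h1, inner_apply_left hRsa, h1, ← inner_apply_left hSsa, h2] at h

theorem finiteDimensional_pencilSpan_Ici (hA : IsStrictlyPositive A) (hB : IsSelfAdjoint B)
    (hc : IsCompactOperator (B - A : H →L[ℂ] H)) {r : ℝ} (hr : 1 < r) :
    FiniteDimensional ℂ (pencilSpan A B (Ici r)) := by
  obtain ⟨c, hc0, hcA⟩ := exists_pos_le_inner hA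
  refine finiteDimensional_of_coercive hc _ (mul_pos (sub_pos.2 hr) hc0) fun v hv => ?_
  have h := le_inner_of_mem_pencilSpan hA.nonneg hB (r := r) (fun s hs => hs) hv
  have h1 := mul_le_mul_of_nonneg_left (hcA v) (sub_pos.2 hr).le
  rw [sub_apply, inner_sub_left, Complex.sub_re]
  linarith

theorem finiteDimensional_pencilSpan_Iic (hA : IsStrictlyPositive A) (hB : IsStrictlyPositive B)
    (hc : IsCompactOperator (B - A : H →L[ℂ] H)) {r : ℝ} (hr : r < 1) :
    FiniteDimensional ℂ (pencilSpan A B (Iic r)) := by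
  have hc' : IsCompactOperator (A - B : H →L[ℂ] H) := by
    simpa using hc.neg
  -- Only the positive part of `Iic r` matters; a positive bound `ρ` can be inverted.
  set ρ := max r (1 / 2) with hρ
  have hρ1 : ρ < 1 := max_lt hr (by norm_num)
  have hρ0 : 0 < ρ := lt_max_of_lt_right (by norm_num)
  have := finiteDimensional_pencilSpan_Ici hB hA.isSelfAdjoint hc' ((one_lt_inv₀ hρ0).2 hρ1)
  have h1 : pencilSpan A B (Iic r) ≤ pencilSpan A B (Ioc 0 ρ) :=
    pencilSpan_le_of_pos hA hB fun s hs hs0 => ⟨hs0, le_trans hs (le_max_left _ _)⟩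
  have h2 : pencilSpan A B (Ioc 0 ρ) ≤ pencilSpan B A (Ici ρ⁻¹) :=
    pencilSpan_swap_le fun s hs => ⟨hs.1.ne', inv_anti₀ hs.1 hs.2⟩
  exact Submodule.finiteDimensional_of_le (h1.trans h2)

/-- Comparison of two pencils `(A, B)`, `(A', B')` with the opposite differences
`B' - A' = A - B` and `A ≤ A'`: counted with multiplicity, the first has at least as many
eigenvalues `≤ 1 - q` as the second has eigenvalues `≥ 1 + q`. The generalized Rayleigh quotients
show that no nonzero vector in the span of the latter eigenvectors is `A`-orthogonal to the former
ones. -/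
theorem rank_pencilSpan_Ici_le {A' B' : H →L[ℂ] H} (hA : IsStrictlyPositive A)
    (hB : IsStrictlyPositive B) (hA' : IsStrictlyPositive A') (hB' : IsSelfAdjoint B')
    (hc : IsCompactOperator (B - A : H →L[ℂ] H)) (hAA' : A ≤ A') (hd : B' - A' = A - B)
    {q : ℝ} (hq : 0 < q) :
    Module.rank ℂ (pencilSpan A' B' (Ici (1 + q))) ≤
      Module.rank ℂ (pencilSpan A B (Iic (1 - q))) := by
  set V := pencilSpan A' B' (Ici (1 + q))
  set W := pencilSpan A B (Iic (1 - q))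
  have : FiniteDimensional ℂ W := finiteDimensional_pencilSpan_Iic hA hB hc (by linarith)
  let g : V →ₗ[ℂ] W :=
    (W.orthogonalProjectionOnto : H →ₗ[ℂ] W) ∘ₗ (A : H →ₗ[ℂ] H) ∘ₗ V.subtype
  refine LinearMap.rank_le_of_injective g ((injective_iff_map_eq_zero g).2 fun v hv => ?_)
  by_contra h0
  have h0' : (v : H) ≠ 0 := by simpa using h0
  have hort : A v ∈ Wᗮ := by
    rw [← Submodule.orthogonalProjectionOnto_eq_zero_iff]
    exact hv
  have h1 := lt_inner_of_forall_inner_eq_zero hA hB.isSelfAdjoint hc h0'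
    ((Submodule.mem_orthogonal _ _).1 hort)
  have h2 := le_inner_of_mem_pencilSpan hA'.nonneg hB' (r := 1 + q) (fun s hs => hs) v.2
  have h3 : 0 ≤ (inner ℂ ((A' - A) v) (v : H)).re :=
    ((ContinuousLinearMap.nonneg_iff_isPositive _).1 (sub_nonneg.2 hAA')).re_inner_nonneg_left v
  have h4 : inner ℂ ((B' - A') v) (v : H) = inner ℂ ((A - B) v) (v : H) := by rw [hd]
  have h5 := congr(Complex.re $h4)
  simp only [sub_apply, inner_sub_left, Complex.sub_re] at h3 h5
  nlinarith

end

/-! ### The eigenvalue sequence of a positive compact perturbation of the identity -/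

section

variable {H : Type*} [NormedAddCommGroup H] [InnerProductSpace ℂ H] {T : H →L[ℂ] H}

theorem bddAbove_setOf_hasEigenvalue (T : H →L[ℂ] H) (p : ℝ → Prop) :
    BddAbove {t : ℝ | End.HasEigenvalue (T : H →ₗ[ℂ] H) (t : ℂ) ∧ p t} := by
  refine ⟨‖T‖, fun t ht => ?_⟩
  obtain ⟨v, hv, h⟩ := (hasEigenvalue_iff_exists T t).1 ht.1
  have h1 := T.le_opNorm v
  rw [h, norm_smul, Complex.norm_real] at h1
  exact (le_abs_self t).trans (le_of_mul_le_mul_right h1 (norm_pos_iff.2 hv))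

theorem eigenvalueCount_anti (T : H →L[ℂ] H) {s t : ℝ} (h : s ≤ t) :
    eigenvalueCount T t ≤ eigenvalueCount T s := by
  rw [eigenvalueCount_eq_rank_pencilSpan, eigenvalueCount_eq_rank_pencilSpan]
  exact Submodule.rank_mono (pencilSpan_mono _ _ (Ici_subset_Ici.2 h))

theorem pencilSpan_one_le {S S' : Set ℝ}
    (h : ∀ s ∈ S, End.HasEigenvalue (T : H →ₗ[ℂ] H) (s : ℂ) → s ∈ S') :
    pencilSpan 1 T S ≤ pencilSpan 1 T S' := by
  refine pencilSpan_le fun s hs v hv => ?_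
  rcases eq_or_ne v 0 with rfl | h0
  · exact zero_mem _
  · exact mem_pencilSpan (h s hs ((hasEigenvalue_iff_exists T s).2 ⟨v, h0, hv⟩)) hv

theorem eigenvalue_eq_zero_of_rank_lt (T : H →L[ℂ] H) {j : ℕ}
    (hj : Module.rank ℂ H < (j : Cardinal)) : eigenvalue T j = 0 := by
  have : {t : ℝ | End.HasEigenvalue (T : H →ₗ[ℂ] H) (t : ℂ) ∧
      (j : Cardinal) ≤ eigenvalueCount T t} = ∅ := by
    rw [Set.eq_empty_iff_forall_notMem]
    rintro t ⟨-, ht⟩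
    exact absurd (ht.trans (Submodule.rank_le _)) (not_le.2 hj)
  rw [eigenvalue, this, Real.sSup_empty]

/-- A dense subspace of finite dimension is the whole space. -/
theorem eq_top_of_orthogonal_eq_bot_of_rank_lt {V : Submodule ℂ H} (hV : Vᗮ = ⊥) {j : ℕ}
    (hj : Module.rank ℂ V < (j : Cardinal)) : V = ⊤ := by
  have : FiniteDimensional ℂ V :=
    Module.rank_lt_aleph0_iff.1 (hj.trans Cardinal.natCast_lt_aleph0)
  exact (Submodule.orthogonal_eq_bot_iff).1 hV

variable [CompleteSpace H]

theorem IsOneAddCompactPos.isSelfAdjoint (hT : IsOneAddCompactPos T) : IsSelfAdjoint T := by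
  simpa using (IsSelfAdjoint.of_nonneg hT.1).add (.one (H →L[ℂ] H))

theorem IsOneAddCompactPos.isStrictlyPositive (hT : IsOneAddCompactPos T) :
    IsStrictlyPositive T :=
  isStrictlyPositive_one.of_le (sub_nonneg.1 hT.1)

theorem IsOneAddCompactPos.one_le (hT : IsOneAddCompactPos T) {s : ℝ} {v : H} (hv : v ≠ 0)
    (h : T v = (s : ℂ) • v) : 1 ≤ s := by
  have h1 := ((ContinuousLinearMap.nonneg_iff_isPositive _).1 hT.1).re_inner_nonneg_left v
  have h2 : 0 < (inner ℂ v v).re := by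
    simpa using inner_apply_self_pos (isStrictlyPositive_one (A := H →L[ℂ] H)) hv
  rw [sub_apply, h, one_apply_eq_self, inner_sub_left, inner_smul_left,
    Complex.conj_ofReal] at h1
  change 0 ≤ ((s : ℂ) * inner ℂ v v - inner ℂ v v).re at h1
  rw [Complex.sub_re, Complex.re_ofReal_mul] at h1
  nlinarith

theorem IsOneAddCompactPos.finiteDimensional (hT : IsOneAddCompactPos T) {t : ℝ} (ht : 1 < t) :
    FiniteDimensional ℂ (pencilSpan 1 T (Ici t)) :=
  finiteDimensional_pencilSpan_Ici isStrictlyPositive_one hT.isSelfAdjoint hT.2 ht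

theorem IsOneAddCompactPos.finite_setOf_hasEigenvalue (hT : IsOneAddCompactPos T) {t : ℝ}
    (ht : 1 < t) :
    {s : ℝ | t ≤ s ∧ End.HasEigenvalue (T : H →ₗ[ℂ] H) (s : ℂ)}.Finite := by
  have := hT.finiteDimensional ht
  have h : ∀ s : {s : ℝ | t ≤ s ∧ End.HasEigenvalue (T : H →ₗ[ℂ] H) (s : ℂ)},
      ∃ v : pencilSpan 1 T (Ici t), End.HasEigenvector (T : H →ₗ[ℂ] H) ((s : ℝ) : ℂ) v := by
    rintro ⟨s, hs, hs'⟩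
    obtain ⟨v, hv⟩ := hs'.exists_hasEigenvector
    exact ⟨⟨v, mem_pencilSpan hs hv.apply_eq_smul⟩, hv⟩
  choose v hv using h
  have hli := End.eigenvectors_linearIndependent' (T : H →ₗ[ℂ] H)
    (fun s : {s : ℝ | t ≤ s ∧ End.HasEigenvalue (T : H →ₗ[ℂ] H) (s : ℂ)} => ((s : ℝ) : ℂ))
    (Complex.ofReal_injective.comp Subtype.val_injective) (fun s => (v s : H)) hv
  have hli' : LinearIndependent ℂ v :=
    LinearIndependent.of_comp (pencilSpan 1 T (Ici t)).subtype hli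
  have := hli'.finite
  exact Set.toFinite _

/-- Above `1`, the `j`-th eigenvalue and the counting function determine each other. Only finitely
many eigenvalues exceed a given `t > 1`, so that the supremum defining the `j`-th eigenvalue is
attained. -/
theorem IsOneAddCompactPos.le_eigenvalue_iff (hT : IsOneAddCompactPos T) {t : ℝ} (ht : 1 < t)
    {j : ℕ} (hj : 1 ≤ j) : t ≤ eigenvalue T j ↔ (j : Cardinal) ≤ eigenvalueCount T t := by
  constructor
  · intro h
    set Λ := {t : ℝ | End.HasEigenvalue (T : H →ₗ[ℂ] H) (t : ℂ) ∧
      (j : Cardinal) ≤ eigenvalueCount T t}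
    have hsup : eigenvalue T j = sSup Λ := rfl
    have hne : Λ.Nonempty := by
      rw [Set.nonempty_iff_ne_empty]
      intro he
      rw [hsup, he, Real.sSup_empty] at h
      linarith
    have hfin : (Λ ∩ Ici ((1 + t) / 2)).Finite :=
      (hT.finite_setOf_hasEigenvalue (t := (1 + t) / 2) (by linarith)).subset
        fun s hs => ⟨hs.2, hs.1.1⟩
    obtain ⟨s, hs, hlt⟩ := exists_lt_of_lt_csSup hne
      (show (1 + t) / 2 < sSup Λ by linarith [hsup ▸ h])
    obtain ⟨m, hm, hmax⟩ := hfin.exists_maximal ⟨s, hs, hlt.le⟩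
    have hle : sSup Λ ≤ m := by
      refine csSup_le hne fun x hx => ?_
      rcases le_total x m with h' | h'
      · exact h'
      · exact hmax ⟨hx, le_trans hm.2 h'⟩ h'
    exact hm.1.2.trans (eigenvalueCount_anti T ((hsup ▸ h).trans hle))
  · intro h
    set F := {s : ℝ | t ≤ s ∧ End.HasEigenvalue (T : H →ₗ[ℂ] H) (s : ℂ)}
    have hfin : F.Finite := hT.finite_setOf_hasEigenvalue ht
    have hne : F.Nonempty := by
      rw [Set.nonempty_iff_ne_empty]
      intro he
      have : pencilSpan 1 T (Ici t) ≤ pencilSpan 1 T ∅ :=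
        pencilSpan_one_le fun s hs hs' => by
          have : s ∈ F := ⟨hs, hs'⟩
          rwa [he] at this
      have h0 : pencilSpan 1 T (Ici t) = ⊥ := by
        rw [eq_bot_iff]
        refine this.trans ?_
        simp [pencilSpan]
      rw [eigenvalueCount_eq_rank_pencilSpan, h0, rank_bot] at h
      have : j = 0 := by exact_mod_cast nonpos_iff_eq_zero.1 h
      omega
    obtain ⟨s, hs, hmin⟩ := hfin.exists_minimal hne
    have hle : pencilSpan 1 T (Ici t) ≤ pencilSpan 1 T (Ici s) :=
      pencilSpan_one_le fun x hx hx' => by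
        rcases le_total s x with h' | h'
        · exact h'
        · exact hmin ⟨hx, hx'⟩ h'
    refine hs.1.trans (le_csSup (bddAbove_setOf_hasEigenvalue T _) ⟨hs.2, h.trans ?_⟩)
    rw [eigenvalueCount_eq_rank_pencilSpan, eigenvalueCount_eq_rank_pencilSpan]
    exact Submodule.rank_mono hle

/-- When fewer than `j ≤ dim H` eigenvalues exceed `1`, the point `1` itself is an eigenvalue and
occupies the `j`-th place. -/
theorem IsOneAddCompactPos.one_le_eigenvalue (hT : IsOneAddCompactPos T) {j : ℕ} (hj : 1 ≤ j)
    (hjH : (j : Cardinal) ≤ Module.rank ℂ H) : 1 ≤ eigenvalue T j := by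
  by_cases hex : ∃ t, 1 < t ∧ (j : Cardinal) ≤ eigenvalueCount T t
  · obtain ⟨t, ht, h⟩ := hex
    exact ht.le.trans ((hT.le_eigenvalue_iff ht hj).2 h)
  push Not at hex
  simp only [eigenvalueCount_eq_rank_pencilSpan] at hex
  -- The spans of the eigenvectors with eigenvalues `≥ t > 1` have bounded dimension, so that they
  -- all lie in one of them.
  obtain ⟨t₀, ht₀, hmax⟩ : ∃ t₀, 1 < t₀ ∧ ∀ t, 1 < t →
      finrank ℂ (pencilSpan 1 T (Ici t)) ≤ finrank ℂ (pencilSpan 1 T (Ici t₀)) := by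
    set N := {n : ℕ | ∃ t, 1 < t ∧ finrank ℂ (pencilSpan 1 T (Ici t)) = n}
    have hN : BddAbove N := by
      refine ⟨j, ?_⟩
      rintro _ ⟨t, ht, rfl⟩
      have := hT.finiteDimensional ht
      have h := hex t ht
      rw [← finrank_eq_rank] at h
      exact_mod_cast h.le
    obtain ⟨t₀, ht₀, h⟩ := Nat.sSup_mem (s := N) ⟨_, 2, one_lt_two, rfl⟩ hN
    exact ⟨t₀, ht₀, fun t ht => h ▸ le_csSup hN ⟨t, ht, rfl⟩⟩
  have hU : pencilSpan 1 T (Ioi 1) ≤ pencilSpan 1 T (Ici t₀) := by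
    refine pencilSpan_le fun s hs v hv => ?_
    have hm : 1 < min s t₀ := lt_min hs ht₀
    have := hT.finiteDimensional hm
    rw [Submodule.eq_of_le_of_finrank_le
      (pencilSpan_mono 1 T (Ici_subset_Ici.2 (min_le_right s t₀))) (hmax _ hm)]
    exact mem_pencilSpan (show min s t₀ ≤ s from min_le_left _ _) hv
  have htot := orthogonal_pencilSpan_one_univ hT.isSelfAdjoint hT.2
  have hone : ∀ s : ℝ, End.HasEigenvalue (T : H →ₗ[ℂ] H) (s : ℂ) → 1 ≤ s := fun s hs => by
    obtain ⟨v, hv, h⟩ := (hasEigenvalue_iff_exists T s).1 hs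
    exact hT.one_le hv h
  have hev : End.HasEigenvalue (T : H →ₗ[ℂ] H) ((1 : ℝ) : ℂ) := by
    by_contra hno
    have h1 : pencilSpan 1 T univ ≤ pencilSpan 1 T (Ici t₀) :=
      (pencilSpan_one_le fun s _ hs =>
        lt_of_le_of_ne (hone s hs) (by rintro rfl; exact hno hs)).trans hU
    have h2 := eq_top_of_orthogonal_eq_bot_of_rank_lt
      (eq_bot_iff.2 ((Submodule.orthogonal_le h1).trans htot.le)) (hex t₀ ht₀)
    have h3 := hex t₀ ht₀
    rw [h2, rank_top] at h3
    exact absurd hjH (not_le.2 h3)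
  refine le_csSup (bddAbove_setOf_hasEigenvalue T _) ⟨hev, ?_⟩
  by_contra! hlt
  rw [eigenvalueCount_eq_rank_pencilSpan] at hlt
  have h1 : pencilSpan 1 T univ ≤ pencilSpan 1 T (Ici 1) :=
    pencilSpan_one_le fun s _ hs => hone s hs
  have h2 := eq_top_of_orthogonal_eq_bot_of_rank_lt
    (eq_bot_iff.2 ((Submodule.orthogonal_le h1).trans htot.le)) hlt
  rw [h2, rank_top] at hlt
  exact absurd hjH (not_le.2 hlt)

theorem eigenvalue_le_of_eigenvalueCount_le {T' : H →L[ℂ] H} (hT' : IsOneAddCompactPos T')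
    (hT : IsOneAddCompactPos T)
    (h : ∀ t, 1 < t → eigenvalueCount T' t ≤ eigenvalueCount T t) {j : ℕ} (hj : 1 ≤ j) :
    eigenvalue T' j ≤ eigenvalue T j := by
  rcases lt_or_ge 1 (eigenvalue T' j) with h1 | h1
  · exact (hT.le_eigenvalue_iff h1 hj).2
      (((hT'.le_eigenvalue_iff h1 hj).1 le_rfl).trans (h _ h1))
  · rcases lt_or_ge (Module.rank ℂ H) (j : Cardinal) with h2 | h2
    · rw [eigenvalue_eq_zero_of_rank_lt T' h2, eigenvalue_eq_zero_of_rank_lt T h2]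
    · exact h1.trans (hT.one_le_eigenvalue hj h2)

end

/-! ### Comparison of ratio operators -/

section

variable {H : Type*} [NormedAddCommGroup H] [InnerProductSpace ℂ H] [CompleteSpace H]
  {A B P Q : H →L[ℂ] H} {f : ℝ → ℝ}

/-- `Q` is `f` times `P` relative to the pencil `(A, B)`: every eigenvector of `(A, B)` with
eigenvalue `x > 0` is an eigenvector of `(P, Q)` with eigenvalue `f x`; moreover `Q` is a compact
perturbation of the positive invertible operator `P`. -/
structure IsMeanPair (f : ℝ → ℝ) (A B P Q : H →L[ℂ] H) : Prop where
  isStrictlyPositive : IsStrictlyPositive P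
  isSelfAdjoint : IsSelfAdjoint Q
  isCompactOperator : IsCompactOperator (Q - P : H →L[ℂ] H)
  apply_eq : ∀ x : ℝ, 0 < x → ∀ v, B v = (x : ℂ) • A v → Q v = (f x : ℂ) • P v

theorem IsMeanPair.apply_ratio (h : IsMeanPair f A B P Q) {x : ℝ} (hx : 0 < x) {v : H}
    (hv : B v = (x : ℂ) • A v) :
    ratio P Q ((P ^ (1 / 2 : ℝ)) v) = (f x : ℂ) • (P ^ (1 / 2 : ℝ)) v := by
  set R := P ^ (-(1 / 2) : ℝ)
  set S := P ^ (1 / 2 : ℝ)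
  have h1 : ∀ v, R (S v) = v := fun v =>
    congr($(rpow_neg_half_mul_rpow_half h.isStrictlyPositive) v)
  have h2 : ∀ v, S (S v) = P v := fun v => congr($(rpow_half_mul_self h.isStrictlyPositive) v)
  have e1 : ratio P Q (S v) = R (Q (R (S v))) := rfl
  rw [e1, h1, h.apply_eq x hx v hv, map_smul, ← h2, h1]

theorem IsMeanPair.map_pencilSpan_le (h : IsMeanPair f A B P Q) {S S' : Set ℝ}
    (hS : ∀ x ∈ S, 0 < x ∧ f x ∈ S') :
    (pencilSpan A B S).map ((P ^ (1 / 2 : ℝ) : H →L[ℂ] H) : H →ₗ[ℂ] H) ≤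
      pencilSpan 1 (ratio P Q) S' := by
  rw [Submodule.map_le_iff_le_comap]
  exact pencilSpan_le fun x hx v hv =>
    mem_pencilSpan (hS x hx).2 (h.apply_ratio (hS x hx).1 hv)

/-- Under `P ^ (1 / 2)` the eigenvectors of the pencil `(A, B)` become a total system. -/
theorem IsMeanPair.orthogonal_map_pencilSpan (h : IsMeanPair f A B P Q)
    (hA : IsStrictlyPositive A) (hB : IsStrictlyPositive B)
    (hc : IsCompactOperator (B - A : H →L[ℂ] H)) :
    ((pencilSpan A B (Ioi 0)).map ((P ^ (1 / 2 : ℝ) : H →L[ℂ] H) : H →ₗ[ℂ] H))ᗮ = ⊥ := by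
  rw [Submodule.eq_bot_iff]
  intro v hv
  have h1 : (P ^ (1 / 2 : ℝ)) v ∈ (pencilSpan A B univ)ᗮ := by
    rw [Submodule.mem_orthogonal]
    intro e he
    rw [← inner_apply_left (isSelfAdjoint_rpow P _)]
    exact (Submodule.mem_orthogonal _ _).1 hv _
      ⟨e, pencilSpan_le_of_pos hA hB (fun s _ hs => hs) he, rfl⟩
  rw [orthogonal_pencilSpan_univ hA hB.isSelfAdjoint hc, Submodule.mem_bot] at h1
  have h2 : (P ^ (-(1 / 2) : ℝ)) ((P ^ (1 / 2 : ℝ)) v) = v :=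
    congr($(rpow_neg_half_mul_rpow_half h.isStrictlyPositive) v)
  rw [← h2, h1, map_zero]

/-- The ratio operator has a total system of eigenvectors, with eigenvalues `f x ≥ 1`. -/
theorem IsMeanPair.isOneAddCompactPos (h : IsMeanPair f A B P Q)
    (hA : IsStrictlyPositive A) (hB : IsStrictlyPositive B)
    (hc : IsCompactOperator (B - A : H →L[ℂ] H)) (hf : ∀ x, 0 < x → 1 ≤ f x) :
    IsOneAddCompactPos (ratio P Q) := by
  have hsa : IsSelfAdjoint (ratio P Q) := isSelfAdjoint_ratio P h.isSelfAdjoint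
  refine ⟨?_, isCompactOperator_ratio_sub_one h.isStrictlyPositive h.isCompactOperator⟩
  rw [ContinuousLinearMap.nonneg_iff_isPositive, ContinuousLinearMap.isPositive_def']
  refine ⟨hsa.sub (.one _), fun v => ?_⟩
  have hcl : IsClosed {v : H | 0 ≤ (ratio P Q - 1).reApplyInnerSelf v} :=
    isClosed_le continuous_const (ContinuousLinearMap.reApplyInnerSelf_continuous _)
  set D := (pencilSpan A B (Ioi 0)).map ((P ^ (1 / 2 : ℝ) : H →L[ℂ] H) : H →ₗ[ℂ] H)
  have hD : D.topologicalClosure = ⊤ :=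
    Submodule.topologicalClosure_eq_top_iff.2 (h.orthogonal_map_pencilSpan hA hB hc)
  have hv : v ∈ D.topologicalClosure := hD ▸ Submodule.mem_top
  refine closure_minimal (s := (D : Set H)) (fun w hw => ?_) hcl hv
  have hw' := h.map_pencilSpan_le (S' := Ici 1) (fun x hx => ⟨hx, hf x hx⟩) hw
  have := le_inner_of_mem_pencilSpan (A := 1) zero_le_one hsa (r := 1) (fun s hs => hs) hw'
  simpa [ContinuousLinearMap.reApplyInnerSelf, inner_sub_left] using this

/-- Above `1`, the eigenvalues of the ratio operator are the values of `f` at the eigenvalues of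
the pencil `(A, B)`, with the same multiplicities. -/
theorem IsMeanPair.eigenvalueCount_eq (h : IsMeanPair f A B P Q)
    (hA : IsStrictlyPositive A) (hB : IsStrictlyPositive B)
    (hc : IsCompactOperator (B - A : H →L[ℂ] H)) {t : ℝ} (ht : 1 < t) :
    eigenvalueCount (ratio P Q) t = Module.rank ℂ (pencilSpan A B {x | 0 < x ∧ t ≤ f x}) := by
  set T := ratio P Q
  have hsa : IsSelfAdjoint T := isSelfAdjoint_ratio P h.isSelfAdjoint
  set S : H →ₗ[ℂ] H := ((P ^ (1 / 2 : ℝ) : H →L[ℂ] H) : H →ₗ[ℂ] H)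
  have hle : (pencilSpan A B {x | 0 < x ∧ t ≤ f x}).map S ≤ pencilSpan 1 T (Ici t) :=
    h.map_pencilSpan_le fun x hx => hx
  have hfin : FiniteDimensional ℂ (pencilSpan 1 T (Ici t)) :=
    finiteDimensional_pencilSpan_Ici isStrictlyPositive_one hsa
      (isCompactOperator_ratio_sub_one h.isStrictlyPositive h.isCompactOperator) ht
  have hfin' := Submodule.finiteDimensional_of_le hle
  have hsup := Submodule.sup_orthogonal_inf_of_hasOrthogonalProjection hle
  -- A vector of the larger space orthogonal to the smaller one is orthogonal to a total system.
  have hbot : ((pencilSpan A B {x | 0 < x ∧ t ≤ f x}).map S)ᗮ ⊓ pencilSpan 1 T (Ici t) = ⊥ := by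
    rw [eq_bot_iff, ← h.orthogonal_map_pencilSpan hA hB hc]
    rintro v ⟨hv1, hv2⟩
    have hsub : pencilSpan A B (Ioi 0) ≤ pencilSpan A B {x | 0 < x ∧ t ≤ f x} ⊔
        pencilSpan A B {x | 0 < x ∧ f x < t} := by
      rw [← pencilSpan_union]
      exact pencilSpan_mono _ _ fun x hx =>
        (le_or_gt t (f x)).elim (fun h => Or.inl ⟨hx, h⟩) fun h => Or.inr ⟨hx, h⟩
    refine Submodule.orthogonal_le (Submodule.map_mono hsub) ?_
    rw [Submodule.map_sup, ← Submodule.inf_orthogonal]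
    refine ⟨hv1, ?_⟩
    rw [SetLike.mem_coe, Submodule.mem_orthogonal]
    intro e he
    have he' := h.map_pencilSpan_le (S' := Iio t) (fun x hx => hx) he
    have hd : Disjoint (Iio t) (Ici t) := by simp
    exact inner_eq_zero_of_mem_pencilSpan (A := 1) (.one _) hsa hd he' hv2
  rw [hbot, sup_bot_eq] at hsup
  rw [eigenvalueCount_eq_rank_pencilSpan, ← hsup]
  exact rank_map_of_leftInverse (rpow_neg_half_mul_rpow_half h.isStrictlyPositive) _

/-- The properties of a quotient `f` of two scalar means that the comparison uses: `f 1 = 1`, `f`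
decreases on `(0, 1]` and increases on `[1, ∞)`, and `f (1 + s) ≤ f (1 - s)`. Thus the value of `f`
at `1 + s` is at most its value at any point of `(0, 1 - s]`. -/
structure IsKyFanFunction (f : ℝ → ℝ) : Prop where
  map_one : f 1 = 1
  continuousOn : ContinuousOn f (Ioi 0)
  monotoneOn : MonotoneOn f (Ici 1)
  antitoneOn : AntitoneOn f (Ioc 0 1)
  reflect_le : ∀ s, 0 < s → s < 1 → f (1 + s) ≤ f (1 - s)

theorem IsKyFanFunction.one_le (hf : IsKyFanFunction f) {x : ℝ} (hx : 0 < x) : 1 ≤ f x := by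
  rcases le_total x 1 with h | h
  · exact hf.map_one.symm.le.trans (hf.antitoneOn ⟨hx, h⟩ ⟨one_pos, le_rfl⟩ h)
  · exact hf.map_one.symm.le.trans (hf.monotoneOn self_mem_Ici h h)

theorem IsKyFanFunction.congr {g : ℝ → ℝ} (hf : IsKyFanFunction f)
    (h : ∀ x, 0 < x → g x = f x) : IsKyFanFunction g where
  map_one := by rw [h 1 one_pos, hf.map_one]
  continuousOn := hf.continuousOn.congr fun x hx => h x hx
  monotoneOn x hx y hy hxy := by
    rw [h x (one_pos.trans_le hx), h y (one_pos.trans_le hy)]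
    exact hf.monotoneOn hx hy hxy
  antitoneOn x hx y hy hxy := by
    rw [h x hx.1, h y hy.1]
    exact hf.antitoneOn hx hy hxy
  reflect_le s h0 h1 := by
    rw [h _ (by linarith), h _ (by linarith)]
    exact hf.reflect_le s h0 h1

section Comparison

variable {A' B' P' Q' : H →L[ℂ] H}

/-- The eigenvalues of the second pencil on the right of `1` are dominated by those of the first
pencil on the left of `1`. -/
theorem IsKyFanFunction.rank_pencilSpan_le (hf : IsKyFanFunction f) (hA : IsStrictlyPositive A)
    (hB : IsStrictlyPositive B) (hA' : IsStrictlyPositive A') (hB' : IsSelfAdjoint B')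
    (hc : IsCompactOperator (B - A : H →L[ℂ] H)) (hAA' : A ≤ A') (hd : B' - A' = A - B)
    {t : ℝ} (ht : 1 < t) :
    Module.rank ℂ (pencilSpan A' B' {x | 1 < x ∧ t ≤ f x}) ≤
      Module.rank ℂ (pencilSpan A B {x | (0 < x ∧ x < 1) ∧ t ≤ f x}) := by
  -- By monotonicity the condition `t ≤ f x` on the right of `1` is the condition `m ≤ x`.
  set N := {x | 1 ≤ x ∧ t ≤ f x} with hN
  have hNcl : IsClosed N :=
    (hf.continuousOn.mono fun x (hx : 1 ≤ x) => one_pos.trans_le hx).preimage_isClosed_of_isClosed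
      isClosed_Ici isClosed_Ici
  have hNb : BddBelow N := ⟨1, fun x hx => hx.1⟩
  rcases N.eq_empty_or_nonempty with he | hne
  · have : pencilSpan A' B' {x | 1 < x ∧ t ≤ f x} = ⊥ := by
      by_contra hbot
      obtain ⟨s, hs, -⟩ := exists_of_pencilSpan_ne_bot hbot
      have : s ∈ N := ⟨hs.1.le, hs.2⟩
      rwa [he] at this
    rw [this, rank_bot]
    exact zero_le
  · have hm := hNcl.csInf_mem hne hNb
    set m := sInf N
    have hm1 : 1 < m := lt_of_le_of_ne hm.1 fun h => by
      have := hm.2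
      rw [← h, hf.map_one] at this
      linarith
    have h1 : pencilSpan A' B' {x | 1 < x ∧ t ≤ f x} ≤ pencilSpan A' B' (Ici (1 + (m - 1))) :=
      pencilSpan_mono _ _ fun x hx => by
        rw [add_sub_cancel]
        exact csInf_le hNb ⟨hx.1.le, hx.2⟩
    have h2 : pencilSpan A B (Iic (1 - (m - 1))) ≤
        pencilSpan A B {x | (0 < x ∧ x < 1) ∧ t ≤ f x} :=
      pencilSpan_le_of_pos hA hB fun x hx hx0 => by
        have hx' : x ≤ 1 - (m - 1) := hx
        have hq : m - 1 < 1 := by linarith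
        refine ⟨⟨hx0, by linarith⟩, ?_⟩
        calc t ≤ f m := hm.2
          _ = f (1 + (m - 1)) := by rw [add_sub_cancel]
          _ ≤ f (1 - (m - 1)) := hf.reflect_le _ (by linarith) hq
          _ ≤ f x := hf.antitoneOn ⟨hx0, by linarith⟩ ⟨by linarith, by linarith⟩ hx'
    exact (Submodule.rank_mono h1).trans ((rank_pencilSpan_Ici_le hA hB hA' hB' hc hAA' hd
      (by linarith)).trans (Submodule.rank_mono h2))

/-- The strict inequality for `f` makes an eigenvalue `y > 1` of the second pencil strictly
dominated by an eigenvalue `x < 1` of the first. -/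
theorem IsKyFanFunction.exists_lt (hf : IsKyFanFunction f)
    (hf' : ∀ s, 0 < s → s < 1 → f (1 + s) < f (1 - s)) (hA : IsStrictlyPositive A)
    (hB : IsStrictlyPositive B) (hA' : IsStrictlyPositive A') (hB' : IsSelfAdjoint B')
    (hc : IsCompactOperator (B - A : H →L[ℂ] H)) (hAA' : A ≤ A') (hd : B' - A' = A - B)
    {y : ℝ} (hy : 1 < y) {v : H} (hv : v ≠ 0) (h : B' v = (y : ℂ) • A' v) :
    ∃ x, 0 < x ∧ f y < f x ∧ ∃ w ≠ 0, B w = (x : ℂ) • A w := by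
  have h1 := rank_pencilSpan_Ici_le hA hB hA' hB' hc hAA' hd (sub_pos.2 hy)
  have hmem : v ∈ pencilSpan A' B' (Ici (1 + (y - 1))) := mem_pencilSpan (by simp) h
  have hne : pencilSpan A B (Iic (1 - (y - 1))) ≠ ⊥ := by
    intro hbot
    rw [hbot, rank_bot, nonpos_iff_eq_zero, Submodule.rank_eq_zero] at h1
    rw [h1] at hmem
    exact hv hmem
  obtain ⟨x, hx, w, hw, hxw⟩ := exists_of_pencilSpan_ne_bot hne
  have hx0 := pencil_eigenvalue_pos hA hB hw hxw
  have hx' : x ≤ 1 - (y - 1) := hx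
  refine ⟨x, hx0, ?_, w, hw, hxw⟩
  calc f y = f (1 + (y - 1)) := by rw [add_sub_cancel]
    _ < f (1 - (y - 1)) := hf' _ (by linarith) (by linarith)
    _ ≤ f x := hf.antitoneOn ⟨hx0, by linarith⟩ ⟨by linarith, by linarith⟩ hx'

/-- The eigenvalues of the second ratio operator are dominated by those of the first. The
eigenvalues of a pencil on the left of `1` become eigenvalues on the right of `1` when the two
operators of the pencil are interchanged. -/
theorem eigenvalue_ratio_le (hf : IsKyFanFunction f) (hfi : IsKyFanFunction fun x => f x⁻¹)
    (hA : IsStrictlyPositive A) (hB : IsStrictlyPositive B)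
    (hc : IsCompactOperator (B - A : H →L[ℂ] H)) (hAA' : A ≤ A') (hBB' : B ≤ B')
    (hd : B' - A' = A - B) (h : IsMeanPair f A B P Q) (h' : IsMeanPair f A' B' P' Q')
    {j : ℕ} (hj : 1 ≤ j) : eigenvalue (ratio P' Q') j ≤ eigenvalue (ratio P Q) j := by
  have hA' := hA.of_le hAA'
  have hB' := hB.of_le hBB'
  have hc' : IsCompactOperator (A - B : H →L[ℂ] H) := by simpa using hc.neg
  have hc'' : IsCompactOperator (B' - A' : H →L[ℂ] H) := hd ▸ hc'
  have hd' : A' - B' = B - A := by rw [← neg_sub, hd, neg_sub]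
  refine eigenvalue_le_of_eigenvalueCount_le
    (h'.isOneAddCompactPos hA' hB' hc'' fun x hx => hf.one_le hx)
    (h.isOneAddCompactPos hA hB hc fun x hx => hf.one_le hx) (fun t ht => ?_) hj
  rw [h'.eigenvalueCount_eq hA' hB' hc'' ht, h.eigenvalueCount_eq hA hB hc ht]
  have h1 := hf.rank_pencilSpan_le hA hB hA' hB'.isSelfAdjoint hc hAA' hd ht
  have h2 : Module.rank ℂ (pencilSpan A' B' {x | (0 < x ∧ x < 1) ∧ t ≤ f x}) ≤
      Module.rank ℂ (pencilSpan A B {x | 1 < x ∧ t ≤ f x}) := by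
    have hs1 : pencilSpan A' B' {x | (0 < x ∧ x < 1) ∧ t ≤ f x} ≤
        pencilSpan B' A' {x | 1 < x ∧ t ≤ f x⁻¹} :=
      pencilSpan_swap_le fun x hx =>
        ⟨hx.1.1.ne', (one_lt_inv₀ hx.1.1).2 hx.1.2, by rw [inv_inv]; exact hx.2⟩
    have hs2 : pencilSpan B A {x | (0 < x ∧ x < 1) ∧ t ≤ f x⁻¹} ≤
        pencilSpan A B {x | 1 < x ∧ t ≤ f x} :=
      pencilSpan_swap_le fun x hx => ⟨hx.1.1.ne', (one_lt_inv₀ hx.1.1).2 hx.1.2, hx.2⟩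
    exact (Submodule.rank_mono hs1).trans
      ((hfi.rank_pencilSpan_le hB hA hB' hA'.isSelfAdjoint hc' hBB' hd' ht).trans
        (Submodule.rank_mono hs2))
  have hsub : pencilSpan A' B' {x | 0 < x ∧ t ≤ f x} ≤ pencilSpan A' B' {x | 1 < x ∧ t ≤ f x} ⊔
      pencilSpan A' B' {x | (0 < x ∧ x < 1) ∧ t ≤ f x} := by
    rw [← pencilSpan_union]
    refine pencilSpan_mono _ _ fun x hx => ?_
    rcases lt_trichotomy x 1 with h1 | h1 | h1
    · exact Or.inr ⟨⟨hx.1, h1⟩, hx.2⟩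
    · have := hx.2
      rw [h1, hf.map_one] at this
      exact absurd ht (not_lt.2 this)
    · exact Or.inl ⟨h1, hx.2⟩
  have hinf : pencilSpan A B {x | (0 < x ∧ x < 1) ∧ t ≤ f x} ⊓
      pencilSpan A B {x | 1 < x ∧ t ≤ f x} = ⊥ := by
    rw [Submodule.eq_bot_iff]
    rintro v ⟨hv1, hv2⟩
    by_contra h0
    have hdis : Disjoint {x | (0 < x ∧ x < 1) ∧ t ≤ f x} {x | 1 < x ∧ t ≤ f x} :=
      Set.disjoint_left.2 fun x hx hx' => lt_asymm hx.1.2 hx'.1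
    have hz := inner_eq_zero_of_mem_pencilSpan hA.isSelfAdjoint hB.isSelfAdjoint hdis hv1 hv2
    have := inner_apply_self_pos hA h0
    rw [hz] at this
    exact lt_irrefl _ this
  calc _ ≤ _ := Submodule.rank_mono hsub
    _ ≤ _ := Submodule.rank_add_le_rank_add_rank _ _
    _ ≤ _ := add_le_add h1 h2
    _ = _ := (Submodule.rank_sup_add_rank_inf_eq _ _).symm
    _ = Module.rank ℂ (pencilSpan A B ({x | (0 < x ∧ x < 1) ∧ t ≤ f x} ∪
        {x | 1 < x ∧ t ≤ f x})) := by rw [hinf, rank_bot, add_zero, ← pencilSpan_union]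
    _ ≤ Module.rank ℂ (pencilSpan A B {x | 0 < x ∧ t ≤ f x}) := by
      refine Submodule.rank_mono (pencilSpan_mono _ _ fun x hx => ?_)
      rcases hx with hx | hx
      · exact ⟨hx.1.1, hx.2⟩
      · exact ⟨one_pos.trans hx.1, hx.2⟩

/-- If `f` satisfies the strict inequalities, the largest eigenvalues of the two ratio operators
differ unless `A = B`. -/
theorem eq_of_eigenvalue_one_eq (hf : IsKyFanFunction f) (hfi : IsKyFanFunction fun x => f x⁻¹)
    (hne : ∀ x, 0 < x → x ≠ 1 → 1 < f x)
    (hlt : ∀ s, 0 < s → s < 1 → f (1 + s) < f (1 - s))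
    (hlti : ∀ s, 0 < s → s < 1 → f (1 + s)⁻¹ < f (1 - s)⁻¹)
    (hA : IsStrictlyPositive A) (hB : IsStrictlyPositive B)
    (hc : IsCompactOperator (B - A : H →L[ℂ] H)) (hAA' : A ≤ A') (hBB' : B ≤ B')
    (hd : B' - A' = A - B) (h : IsMeanPair f A B P Q) (h' : IsMeanPair f A' B' P' Q')
    (heq : eigenvalue (ratio P' Q') 1 = eigenvalue (ratio P Q) 1) : A = B := by
  have hA' := hA.of_le hAA'
  have hB' := hB.of_le hBB'
  have hc' : IsCompactOperator (A - B : H →L[ℂ] H) := by simpa using hc.neg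
  have hc'' : IsCompactOperator (B' - A' : H →L[ℂ] H) := hd ▸ hc'
  have hd' : A' - B' = B - A := by rw [← neg_sub, hd, neg_sub]
  have hT := h.isOneAddCompactPos hA hB hc fun x hx => hf.one_le hx
  have hT' := h'.isOneAddCompactPos hA' hB' hc'' fun x hx => hf.one_le hx
  -- An eigenvalue `x` of the pencil contributes the eigenvalue `f x` to the ratio operator.
  have hev : ∀ {A B P Q : H →L[ℂ] H}, IsMeanPair f A B P Q → IsStrictlyPositive A →
      IsStrictlyPositive B → IsCompactOperator (B - A : H →L[ℂ] H) →
      IsOneAddCompactPos (ratio P Q) → ∀ x, 0 < x → 1 < f x →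
      (∃ v ≠ 0, B v = (x : ℂ) • A v) → f x ≤ eigenvalue (ratio P Q) 1 := by
    rintro A B P Q h hA hB hc hT x hx h1 ⟨v, hv, hxv⟩
    rw [hT.le_eigenvalue_iff h1 le_rfl, h.eigenvalueCount_eq hA hB hc h1, Nat.cast_one,
      Cardinal.one_le_iff_ne_zero, Ne, Submodule.rank_eq_zero]
    intro hbot
    have : v ∈ pencilSpan A B {y | 0 < y ∧ f x ≤ f y} :=
      mem_pencilSpan (show x ∈ {y | 0 < y ∧ f x ≤ f y} from ⟨hx, le_rfl⟩) hxv
    rw [hbot] at this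
    exact hv this
  by_contra hAB
  -- By totality of the eigenvectors, `A' ≠ B'` gives an eigenvalue `y₀ ≠ 1` of the second pencil.
  obtain ⟨y₀, hy₀, hy₀1, v₀, hv₀, hyv₀⟩ : ∃ y : ℝ, 0 < y ∧ y ≠ 1 ∧ ∃ v ≠ 0,
      B' v = (y : ℂ) • A' v := by
    by_contra! hno
    have h1 : pencilSpan A' B' univ ≤ LinearMap.ker ((B' - A' : H →L[ℂ] H) : H →ₗ[ℂ] H) := by
      refine pencilSpan_le fun s _ v hv => ?_
      rcases eq_or_ne v 0 with rfl | h0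
      · exact zero_mem _
      · have hs := pencil_eigenvalue_pos hA' hB' h0 hv
        by_cases hs1 : s = 1
        · simp [hv, hs1]
        · exact absurd hv (hno s hs hs1 v h0)
    have h2 : (LinearMap.ker ((B' - A' : H →L[ℂ] H) : H →ₗ[ℂ] H))ᗮ = ⊥ := by
      rw [eq_bot_iff, ← orthogonal_pencilSpan_univ hA' hB'.isSelfAdjoint hc'']
      exact Submodule.orthogonal_le h1
    have h3 : IsClosed (LinearMap.ker ((B' - A' : H →L[ℂ] H) : H →ₗ[ℂ] H) : Set H) :=
      (B' - A').isClosed_ker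
    have h4 := (Submodule.topologicalClosure_eq_top_iff).2 h2
    rw [h3.submodule_topologicalClosure_eq] at h4
    apply hAB
    rw [← sub_eq_zero, ← hd]
    ext v
    have : v ∈ LinearMap.ker ((B' - A' : H →L[ℂ] H) : H →ₗ[ℂ] H) := h4 ▸ Submodule.mem_top
    exact this
  have ht : 1 < eigenvalue (ratio P' Q') 1 :=
    (hne y₀ hy₀ hy₀1).trans_le
      (hev h' hA' hB' hc'' hT' y₀ hy₀ (hne y₀ hy₀ hy₀1) ⟨v₀, hv₀, hyv₀⟩)
  set t := eigenvalue (ratio P' Q') 1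
  have hcount := (hT'.le_eigenvalue_iff ht le_rfl).1 le_rfl
  rw [h'.eigenvalueCount_eq hA' hB' hc'' ht, Nat.cast_one, Cardinal.one_le_iff_ne_zero, Ne,
    Submodule.rank_eq_zero] at hcount
  obtain ⟨y, ⟨hy0, hty⟩, v, hv, hyv⟩ := exists_of_pencilSpan_ne_bot hcount
  obtain ⟨x, hx0, hx, hxw⟩ : ∃ x, 0 < x ∧ f y < f x ∧ ∃ w ≠ 0, B w = (x : ℂ) • A w := by
    rcases lt_trichotomy y 1 with h1 | h1 | h1
    · obtain ⟨x, hx0, hx, w, hw, hxw⟩ := hfi.exists_lt hlti hB hA hB' hA'.isSelfAdjoint hc' hBB'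
        hd' ((one_lt_inv₀ hy0).2 h1) hv (apply_eq_inv_smul hy0.ne' hyv)
      rw [inv_inv] at hx
      exact ⟨x⁻¹, inv_pos.2 hx0, hx, w, hw, apply_eq_inv_smul hx0.ne' hxw⟩
    · rw [h1, hf.map_one] at hty
      exact absurd ht (not_lt.2 hty)
    · exact hf.exists_lt hlt hA hB hA' hB'.isSelfAdjoint hc hAA' hd h1 hv hyv
  have := hev h hA hB hc hT x hx0 (ht.trans_le (hty.trans hx.le)) hxw
  rw [← heq] at this
  linarith

end Comparison

end

/-! ### The scalar quotients of the means -/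

section

/-- The function `x ↦ (1 - μ + μ x) / x ^ μ` representing the quotient of the weighted arithmetic
mean of `1` and `x` by their geometric mean. -/
def arithGeomRatio (μ x : ℝ) : ℝ := (1 - μ + μ * x) * x ^ (-μ)

theorem hasDerivAt_arithGeomRatio (μ : ℝ) {x : ℝ} (hx : 0 < x) :
    HasDerivAt (arithGeomRatio μ) (μ * (1 - μ) * x ^ (-μ - 1) * (x - 1)) x := by
  have h1 : HasDerivAt (fun x : ℝ => 1 - μ + μ * x) μ x := by
    simpa using ((hasDerivAt_id x).const_mul μ).const_add (1 - μ)
  have h2 : HasDerivAt (fun x : ℝ => x ^ (-μ)) (-μ * x ^ (-μ - 1)) x :=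
    Real.hasDerivAt_rpow_const (Or.inl hx.ne')
  refine (h1.mul h2).congr_deriv ?_
  have h3 : x ^ (-μ) = x ^ (-μ - 1) * x := by
    rw [← Real.rpow_add_one hx.ne']; ring_nf
  rw [h3]
  ring

theorem arithGeomRatio_inv (μ : ℝ) {x : ℝ} (hx : 0 < x) :
    arithGeomRatio μ x⁻¹ = arithGeomRatio (1 - μ) x := by
  rw [arithGeomRatio, arithGeomRatio, Real.inv_rpow hx.le, ← Real.rpow_neg hx.le, neg_neg]
  have h3 : x ^ μ = x ^ (-(1 - μ)) * x := by
    rw [← Real.rpow_add_one hx.ne']; ring_nf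
  rw [h3]
  field_simp
  ring

theorem arithGeomRatio_one (μ : ℝ) : arithGeomRatio μ 1 = 1 := by
  simp [arithGeomRatio]

theorem continuousOn_arithGeomRatio (μ : ℝ) : ContinuousOn (arithGeomRatio μ) (Ioi 0) :=
  fun _ hx => (hasDerivAt_arithGeomRatio μ hx).continuousAt.continuousWithinAt

section Strict

variable {μ : ℝ} (h0 : 0 < μ) (h1 : μ < 1)
include h0 h1

theorem strictMonoOn_arithGeomRatio : StrictMonoOn (arithGeomRatio μ) (Ici 1) := by
  refine strictMonoOn_of_deriv_pos (convex_Ici 1)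
    ((continuousOn_arithGeomRatio μ).mono fun x (hx : 1 ≤ x) => one_pos.trans_le hx) fun x hx => ?_
  rw [interior_Ici] at hx
  have hx' : (1 : ℝ) < x := hx
  have hx0 : 0 < x := one_pos.trans hx'
  rw [(hasDerivAt_arithGeomRatio μ hx0).deriv]
  have := Real.rpow_pos_of_pos hx0 (-μ - 1)
  have := sub_pos.2 h1
  have := sub_pos.2 hx'
  positivity

theorem strictAntiOn_arithGeomRatio : StrictAntiOn (arithGeomRatio μ) (Ioc 0 1) := by
  refine strictAntiOn_of_deriv_neg (convex_Ioc 0 1)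
    ((continuousOn_arithGeomRatio μ).mono fun x hx => hx.1) fun x hx => ?_
  rw [interior_Ioc] at hx
  rw [(hasDerivAt_arithGeomRatio μ hx.1).deriv]
  have := Real.rpow_pos_of_pos hx.1 (-μ - 1)
  have := sub_pos.2 h1
  exact mul_neg_of_pos_of_neg (by positivity) (sub_neg.2 hx.2)

/-- The difference of the two sides vanishes at `s = 0` and has derivative
`μ (1 - μ) s ((1 - s) ^ (-μ - 1) - (1 + s) ^ (-μ - 1)) > 0`. -/
theorem arithGeomRatio_reflect_lt {s : ℝ} (hs0 : 0 < s) (hs1 : s < 1) :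
    arithGeomRatio μ (1 + s) < arithGeomRatio μ (1 - s) := by
  have hderiv : ∀ x ∈ Ico (0 : ℝ) 1,
      HasDerivAt (fun s => arithGeomRatio μ (1 - s) - arithGeomRatio μ (1 + s))
        (μ * (1 - μ) * x * ((1 - x) ^ (-μ - 1) - (1 + x) ^ (-μ - 1))) x := by
    intro x hx
    have e1 : HasDerivAt (fun s : ℝ => 1 - s) (-1) x := by
      simpa using (hasDerivAt_id x).const_sub 1
    have e2 : HasDerivAt (fun s : ℝ => 1 + s) 1 x := by
      simpa using (hasDerivAt_id x).const_add 1
    have d1 := (hasDerivAt_arithGeomRatio μ (sub_pos.2 hx.2)).comp x e1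
    have d2 := (hasDerivAt_arithGeomRatio μ (show 0 < 1 + x by linarith [hx.1])).comp x e2
    refine (d1.sub d2).congr_deriv ?_
    ring
  have hmono : StrictMonoOn (fun s => arithGeomRatio μ (1 - s) - arithGeomRatio μ (1 + s))
      (Ico 0 1) := by
    refine strictMonoOn_of_deriv_pos (convex_Ico 0 1)
      (fun x hx => (hderiv x hx).continuousAt.continuousWithinAt) fun x hx => ?_
    rw [interior_Ico] at hx
    rw [(hderiv x ⟨hx.1.le, hx.2⟩).deriv]
    have e1 : (1 + x) ^ (-μ - 1) < (1 - x) ^ (-μ - 1) :=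
      Real.rpow_lt_rpow_of_neg (by linarith [hx.2]) (by linarith [hx.1]) (by linarith)
    have e2 := sub_pos.2 h1
    have e3 := hx.1
    have e4 := sub_pos.2 e1
    positivity
  have := hmono (left_mem_Ico.2 one_pos) ⟨hs0.le, hs1⟩ hs0
  simpa using this

end Strict

theorem isKyFanFunction_arithGeomRatio {μ : ℝ} (h0 : 0 ≤ μ) (h1 : μ ≤ 1) :
    IsKyFanFunction (arithGeomRatio μ) := by
  have hconst : (∀ x, 0 < x → arithGeomRatio μ x = 1) → IsKyFanFunction (arithGeomRatio μ) :=
    IsKyFanFunction.congr (f := fun _ => 1)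
      ⟨rfl, continuousOn_const, monotoneOn_const, antitoneOn_const, fun _ _ _ => le_rfl⟩
  -- For `μ = 0` and `μ = 1` the two means coincide.
  rcases h0.eq_or_lt with rfl | h0
  · exact hconst fun x _ => by simp [arithGeomRatio]
  rcases h1.eq_or_lt with rfl | h1
  · exact hconst fun x hx => by simp [arithGeomRatio, Real.rpow_neg_one, hx.ne']
  exact ⟨arithGeomRatio_one μ, continuousOn_arithGeomRatio μ,
    (strictMonoOn_arithGeomRatio h0 h1).monotoneOn, (strictAntiOn_arithGeomRatio h0 h1).antitoneOn,
    fun s hs0 hs1 => (arithGeomRatio_reflect_lt h0 h1 hs0 hs1).le⟩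

theorem isKyFanFunction_arithGeomRatio_inv {μ : ℝ} (h0 : 0 ≤ μ) (h1 : μ ≤ 1) :
    IsKyFanFunction fun x => arithGeomRatio μ x⁻¹ :=
  (isKyFanFunction_arithGeomRatio (sub_nonneg.2 h1) (sub_le_self 1 h0)).congr
    fun _ hx => arithGeomRatio_inv μ hx

theorem one_lt_arithGeomRatio {μ : ℝ} (h0 : 0 < μ) (h1 : μ < 1) {x : ℝ} (hx : 0 < x)
    (hx1 : x ≠ 1) : 1 < arithGeomRatio μ x := by
  rw [← arithGeomRatio_one μ]
  rcases lt_or_gt_of_ne hx1 with h | h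
  · exact strictAntiOn_arithGeomRatio h0 h1 ⟨hx, h.le⟩ ⟨one_pos, le_rfl⟩ h
  · exact strictMonoOn_arithGeomRatio h0 h1 self_mem_Ici h.le h

theorem arithGeomRatio_inv_reflect_lt {μ : ℝ} (h0 : 0 < μ) (h1 : μ < 1) {s : ℝ} (hs0 : 0 < s)
    (hs1 : s < 1) : arithGeomRatio μ (1 + s)⁻¹ < arithGeomRatio μ (1 - s)⁻¹ := by
  rw [arithGeomRatio_inv μ (by linarith), arithGeomRatio_inv μ (by linarith)]
  exact arithGeomRatio_reflect_lt (sub_pos.2 h1) (by linarith) hs0 hs1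

theorem IsKyFanFunction.mul {f g : ℝ → ℝ} (hf : IsKyFanFunction f) (hg : IsKyFanFunction g) :
    IsKyFanFunction fun x => f x * g x where
  map_one := by rw [hf.map_one, hg.map_one, one_mul]
  continuousOn := hf.continuousOn.mul hg.continuousOn
  monotoneOn x (hx : 1 ≤ x) y (hy : 1 ≤ y) hxy :=
    mul_le_mul (hf.monotoneOn hx hy hxy) (hg.monotoneOn hx hy hxy)
      (zero_le_one.trans (hg.one_le (one_pos.trans_le hx)))
      (zero_le_one.trans (hf.one_le (one_pos.trans_le hy)))
  antitoneOn x hx y hy hxy :=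
    mul_le_mul (hf.antitoneOn hx hy hxy) (hg.antitoneOn hx hy hxy)
      (zero_le_one.trans (hg.one_le hy.1)) (zero_le_one.trans (hf.one_le hx.1))
  reflect_le s hs0 hs1 :=
    mul_le_mul (hf.reflect_le s hs0 hs1) (hg.reflect_le s hs0 hs1)
      (zero_le_one.trans (hg.one_le (by linarith))) (zero_le_one.trans (hf.one_le (by linarith)))

end

/-! ### The three means and the pencil -/

section

variable {H : Type*} [NormedAddCommGroup H] [InnerProductSpace ℂ H] {A B : H →L[ℂ] H} {μ : ℝ}

theorem arithMean_apply (μ : ℝ) {x : ℝ} {v : H} (hv : B v = (x : ℂ) • A v) :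
    arithMean μ A B v = ((1 - μ + μ * x : ℝ) : ℂ) • A v := by
  have : arithMean μ A B v = (1 - μ) • A v + μ • B v := rfl
  rw [this, hv, Complex.coe_smul, Complex.coe_smul, add_smul, mul_smul]

theorem isCompactOperator_arithMean_sub (hc : IsCompactOperator (B - A : H →L[ℂ] H)) (μ : ℝ) :
    IsCompactOperator (arithMean μ A B - A : H →L[ℂ] H) := by
  have h : arithMean μ A B - A = μ • (B - A) := by
    rw [arithMean, sub_smul, one_smul, smul_sub]
    abel
  rw [h]
  exact hc.smul μ

variable [CompleteSpace H]

/-- Quotients of means multiply. -/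
theorem IsMeanPair.trans {f g : ℝ → ℝ} {P Q R : H →L[ℂ] H} (h : IsMeanPair f A B P Q)
    (h' : IsMeanPair g A B Q R) : IsMeanPair (fun x => g x * f x) A B P R where
  isStrictlyPositive := h.isStrictlyPositive
  isSelfAdjoint := h'.isSelfAdjoint
  isCompactOperator := by
    simpa using h'.isCompactOperator.add h.isCompactOperator
  apply_eq x hx v hv := by
    rw [h'.apply_eq x hx v hv, h.apply_eq x hx v hv, smul_smul, Complex.ofReal_mul]

/-- Since `(x ^ μ - a ^ μ) / (x - a)` extends continuously to `x = a`, the operator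
`X ^ μ - a ^ μ` is a multiple of `X - a`. -/
theorem exists_rpow_sub_eq_mul {X : H →L[ℂ] H} (hX : IsStrictlyPositive X) (μ : ℝ) {a : ℝ}
    (ha : 0 < a) : ∃ L : H →L[ℂ] H, X ^ μ - ((a ^ μ : ℝ) : ℂ) • 1 = L * (X - (a : ℂ) • 1) := by
  have hsa : IsSelfAdjoint X := hX.isSelfAdjoint
  have hspec : spectrum ℝ X ⊆ Ioi 0 := fun x hx => hX.spectrum_pos hx
  have hcont : ContinuousOn (fun x : ℝ => x ^ μ) (Ioi 0) := fun x (hx : 0 < x) =>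
    (Real.continuousAt_rpow_const x μ (Or.inl hx.ne')).continuousWithinAt
  have hslope : ContinuousOn (dslope (fun x : ℝ => x ^ μ) a) (spectrum ℝ X) :=
    ((continuousOn_dslope (Ioi_mem_nhds ha)).2 ⟨hcont,
      (Real.hasDerivAt_rpow_const (Or.inl ha.ne')).differentiableAt⟩).mono hspec
  refine ⟨cfc (dslope (fun x : ℝ => x ^ μ) a) X, ?_⟩
  have e1 : X - (a : ℂ) • 1 = cfc (fun x : ℝ => x - a) X := by
    rw [cfc_sub _ _ X, cfc_id' ℝ X, cfc_const a X, Algebra.algebraMap_eq_smul_one,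
      Complex.coe_smul]
  have e2 : X ^ μ - ((a ^ μ : ℝ) : ℂ) • 1 = cfc (fun x : ℝ => x ^ μ - a ^ μ) X := by
    rw [cfc_sub _ _ X (hcont.mono hspec), cfc_const _ X, CFC.rpow_eq_cfc_real hX.nonneg,
      Algebra.algebraMap_eq_smul_one, Complex.coe_smul]
  rw [e1, e2, ← cfc_mul _ _ X hslope (by fun_prop)]
  refine cfc_congr fun x _ => ?_
  have := sub_smul_dslope (fun x : ℝ => x ^ μ) a x
  rw [smul_eq_mul] at this
  rw [← this, mul_comm]

theorem isStrictlyPositive_geomMean (hA : IsStrictlyPositive A) (hB : IsStrictlyPositive B)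
    (μ : ℝ) : IsStrictlyPositive (geomMean μ A B) :=
  IsStrictlyPositive.conjugate_of_isUnit_of_isSelfAdjoint _ _ (hA.rpow A _).isUnit
    (isSelfAdjoint_rpow _ _) ((isStrictlyPositive_ratio hA hB).rpow _ μ)

theorem isCompactOperator_geomMean_sub (hA : IsStrictlyPositive A) (hB : IsStrictlyPositive B)
    (hc : IsCompactOperator (B - A : H →L[ℂ] H)) (μ : ℝ) :
    IsCompactOperator (geomMean μ A B - A : H →L[ℂ] H) := by
  obtain ⟨L, hL⟩ := exists_rpow_sub_eq_mul (isStrictlyPositive_ratio hA hB) μ one_pos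
  simp only [Real.one_rpow, Complex.ofReal_one, one_smul] at hL
  have h1 : geomMean μ A B - A = A ^ (1 / 2 : ℝ) * L * (ratio A B - 1) * A ^ (1 / 2 : ℝ) := by
    rw [mul_assoc (A ^ (1 / 2 : ℝ)) L, ← hL, mul_sub, sub_mul, mul_one, rpow_half_mul_self hA]
    rfl
  rw [h1]
  exact isCompactOperator_mul_mul (isCompactOperator_ratio_sub_one hA hc) _ _

theorem geomMean_apply (hA : IsStrictlyPositive A) (hB : IsStrictlyPositive B) (μ : ℝ) {x : ℝ}
    (hx : 0 < x) {v : H} (hv : B v = (x : ℂ) • A v) :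
    geomMean μ A B v = ((x ^ μ : ℝ) : ℂ) • A v := by
  obtain ⟨L, hL⟩ := exists_rpow_sub_eq_mul (isStrictlyPositive_ratio hA hB) μ hx
  set R := A ^ (-(1 / 2) : ℝ)
  set S := A ^ (1 / 2 : ℝ)
  have h1 : ∀ v, R (S v) = v := fun v => congr($(rpow_neg_half_mul_rpow_half hA) v)
  have h2 : ∀ v, S (S v) = A v := fun v => congr($(rpow_half_mul_self hA) v)
  have e1 : ratio A B (S v) = (x : ℂ) • S v := by
    have : ratio A B (S v) = R (B (R (S v))) := rfl
    rw [this, h1, hv, map_smul, ← h2, h1]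
  have e2 : (ratio A B ^ μ) (S v) = ((x ^ μ : ℝ) : ℂ) • S v := by
    have := congr($hL (S v))
    have h0 : (L * (ratio A B - (x : ℂ) • 1)) (S v) = 0 := by
      change L (ratio A B (S v) - (x : ℂ) • S v) = 0
      rw [e1, sub_self, map_zero]
    rw [h0] at this
    exact sub_eq_zero.1 this
  have e3 : geomMean μ A B v = S ((ratio A B ^ μ) (S v)) := rfl
  rw [e3, e2, map_smul, h2]

theorem isStrictlyPositive_arithMean (h0 : 0 ≤ μ) (h1 : μ ≤ 1) (hA : IsStrictlyPositive A)
    (hB : IsStrictlyPositive B) : IsStrictlyPositive (arithMean μ A B) := by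
  rw [arithMean]
  rcases h0.eq_or_lt with rfl | h0
  · simpa using hA
  · exact (IsStrictlyPositive.smul h0 hB).nonneg_add (smul_nonneg (sub_nonneg.2 h1) hA.nonneg)

theorem isStrictlyPositive_harmMean (h0 : 0 ≤ μ) (h1 : μ ≤ 1) (hA : IsStrictlyPositive A)
    (hB : IsStrictlyPositive B) : IsStrictlyPositive (harmMean μ A B) :=
  (isStrictlyPositive_arithMean h0 h1 hA.ringInverse hB.ringInverse).ringInverse

theorem isCompactOperator_harmMean_sub (h0 : 0 ≤ μ) (h1 : μ ≤ 1) (hA : IsStrictlyPositive A)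
    (hB : IsStrictlyPositive B) (hc : IsCompactOperator (B - A : H →L[ℂ] H)) :
    IsCompactOperator (harmMean μ A B - A : H →L[ℂ] H) := by
  set D := arithMean μ (Ring.inverse A) (Ring.inverse B)
  have hDp : IsStrictlyPositive D := isStrictlyPositive_arithMean h0 h1 hA.ringInverse
    hB.ringInverse
  have e0 : harmMean μ A B = Ring.inverse D := rfl
  have hinv : Ring.inverse B - Ring.inverse A = -(Ring.inverse B * (B - A) * Ring.inverse A) := by
    rw [mul_sub, sub_mul, Ring.inverse_mul_cancel _ hB.isUnit, one_mul, mul_assoc,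
      Ring.mul_inverse_cancel _ hA.isUnit, mul_one, neg_sub]
  have h1 : IsCompactOperator (D - Ring.inverse A : H →L[ℂ] H) := by
    refine isCompactOperator_arithMean_sub ?_ μ
    rw [hinv]
    exact (isCompactOperator_mul_mul hc _ _).neg
  have h2 : harmMean μ A B - A = -(Ring.inverse D * (D - Ring.inverse A) * A) := by
    rw [e0, mul_sub, sub_mul, Ring.inverse_mul_cancel _ hDp.isUnit, one_mul, mul_assoc,
      Ring.inverse_mul_cancel _ hA.isUnit, mul_one, neg_sub]
  rw [h2]
  exact (isCompactOperator_mul_mul h1 _ _).neg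

theorem harmMean_apply (h0 : 0 ≤ μ) (h1 : μ ≤ 1) (hA : IsStrictlyPositive A)
    (hB : IsStrictlyPositive B) {x : ℝ} (hx : 0 < x) {v : H} (hv : B v = (x : ℂ) • A v) :
    A v = ((1 - μ + μ * x⁻¹ : ℝ) : ℂ) • harmMean μ A B v := by
  set D := arithMean μ (Ring.inverse A) (Ring.inverse B)
  have hDp : IsStrictlyPositive D := isStrictlyPositive_arithMean h0 h1 hA.ringInverse
    hB.ringInverse
  have hDi : ∀ w, Ring.inverse D (D w) = w := fun w =>
    congr($(Ring.inverse_mul_cancel _ hDp.isUnit) w)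
  have hAi : ∀ w, Ring.inverse A (A w) = w := fun w =>
    congr($(Ring.inverse_mul_cancel _ hA.isUnit) w)
  have hBi : ∀ w, Ring.inverse B (B w) = w := fun w =>
    congr($(Ring.inverse_mul_cancel _ hB.isUnit) w)
  have e0 : harmMean μ A B = Ring.inverse D := rfl
  have e1 : D (A v) = ((1 - μ + μ * x⁻¹ : ℝ) : ℂ) • v := by
    have h := arithMean_apply (A := Ring.inverse A) (B := Ring.inverse B) μ (x := x⁻¹) (v := A v)
      (by rw [hAi, apply_eq_inv_smul hx.ne' hv, map_smul, hBi])
    rwa [hAi] at h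
  rw [e0, ← map_smul, ← e1, hDi]

theorem isMeanPair_geomMean_arithMean (h0 : 0 ≤ μ) (h1 : μ ≤ 1) (hA : IsStrictlyPositive A)
    (hB : IsStrictlyPositive B) (hc : IsCompactOperator (B - A : H →L[ℂ] H)) :
    IsMeanPair (arithGeomRatio μ) A B (geomMean μ A B) (arithMean μ A B) where
  isStrictlyPositive := isStrictlyPositive_geomMean hA hB μ
  isSelfAdjoint := (isStrictlyPositive_arithMean h0 h1 hA hB).isSelfAdjoint
  isCompactOperator := by
    simpa using (isCompactOperator_arithMean_sub hc μ).sub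
      (isCompactOperator_geomMean_sub hA hB hc μ)
  apply_eq x hx v hv := by
    rw [arithMean_apply μ hv, geomMean_apply hA hB μ hx hv, smul_smul, ← Complex.ofReal_mul,
      arithGeomRatio, mul_assoc, ← Real.rpow_add hx, neg_add_cancel, Real.rpow_zero, mul_one]

theorem isMeanPair_harmMean_geomMean (h0 : 0 ≤ μ) (h1 : μ ≤ 1) (hA : IsStrictlyPositive A)
    (hB : IsStrictlyPositive B) (hc : IsCompactOperator (B - A : H →L[ℂ] H)) :
    IsMeanPair (fun x => arithGeomRatio μ x⁻¹) A B (harmMean μ A B) (geomMean μ A B) where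
  isStrictlyPositive := isStrictlyPositive_harmMean h0 h1 hA hB
  isSelfAdjoint := (isStrictlyPositive_geomMean hA hB μ).isSelfAdjoint
  isCompactOperator := by
    simpa using (isCompactOperator_geomMean_sub hA hB hc μ).sub
      (isCompactOperator_harmMean_sub h0 h1 hA hB hc)
  apply_eq x hx v hv := by
    rw [geomMean_apply hA hB μ hx hv, harmMean_apply h0 h1 hA hB hx hv, smul_smul,
      ← Complex.ofReal_mul, arithGeomRatio, Real.inv_rpow hx.le, ← Real.rpow_neg hx.le, neg_neg,
      mul_comm]

theorem isMeanPair_harmMean_arithMean (h0 : 0 ≤ μ) (h1 : μ ≤ 1) (hA : IsStrictlyPositive A)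
    (hB : IsStrictlyPositive B) (hc : IsCompactOperator (B - A : H →L[ℂ] H)) :
    IsMeanPair (fun x => arithGeomRatio μ x * arithGeomRatio μ x⁻¹) A B (harmMean μ A B)
      (arithMean μ A B) :=
  (isMeanPair_harmMean_geomMean h0 h1 hA hB hc).trans (isMeanPair_geomMean_arithMean h0 h1 hA hB hc)

end

/-! ### The equality condition -/

section

variable {H : Type*} [NormedAddCommGroup H] [InnerProductSpace ℂ H] [CompleteSpace H]
  {A B P Q P' Q' : H →L[ℂ] H} {f : ℝ → ℝ}

theorem IsMeanPair.ratio_eq_one (h : IsMeanPair f A A P Q) (hf : f 1 = 1) : ratio P Q = 1 := by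
  have : Q = P := by
    ext v
    simpa [hf] using h.apply_eq 1 one_pos v (by simp)
  rw [this, ratio_self h.isStrictlyPositive]

theorem forall_eigenvalue_eq_iff (hf : IsKyFanFunction f) (hfi : IsKyFanFunction fun x => f x⁻¹)
    (hne : ∀ x, 0 < x → x ≠ 1 → 1 < f x)
    (hlt : ∀ s, 0 < s → s < 1 → f (1 + s) < f (1 - s))
    (hlti : ∀ s, 0 < s → s < 1 → f (1 + s)⁻¹ < f (1 - s)⁻¹)
    (hA : IsStrictlyPositive A) (hB : IsStrictlyPositive B)
    (hc : IsCompactOperator (B - A : H →L[ℂ] H)) (hAA' : A ≤ 1 - A) (hBB' : B ≤ 1 - B)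
    (h : IsMeanPair f A B P Q) (h' : IsMeanPair f (1 - A) (1 - B) P' Q') :
    (∀ j : ℕ, 1 ≤ j → eigenvalue (ratio P' Q') j = eigenvalue (ratio P Q) j) ↔ A = B := by
  constructor
  · intro heq
    exact eq_of_eigenvalue_one_eq hf hfi hne hlt hlti hA hB hc hAA' hBB' (by abel) h h'
      (heq 1 le_rfl)
  · rintro rfl j -
    rw [h.ratio_eq_one hf.map_one, h'.ratio_eq_one hf.map_one]

end

end KyFan

end

theorem mainTheorem10 {H : Type*} [NormedAddCommGroup H] [InnerProductSpace ℂ H]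
    [CompleteSpace H] [TopologicalSpace.SeparableSpace H]
    (μ : ℝ) (hμ₀ : 0 ≤ μ) (hμ₁ : μ ≤ 1) (A B : H →L[ℂ] H)
    (hA : IsStrictlyPositive A) (hA' : A ≤ (1 / 2 : ℝ) • (1 : H →L[ℂ] H))
    (hB : IsStrictlyPositive B) (hB' : B ≤ (1 / 2 : ℝ) • (1 : H →L[ℂ] H))
    (hAB : IsCompactOperator (A - B)) :
    -- all six ratio operators are of the form `I + K` with `K` compact and positive
    (KyFan.IsOneAddCompactPos
        (KyFan.ratio (KyFan.geomMean μ A B) (KyFan.arithMean μ A B)) ∧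
      KyFan.IsOneAddCompactPos
        (KyFan.ratio (KyFan.harmMean μ A B) (KyFan.geomMean μ A B)) ∧
      KyFan.IsOneAddCompactPos
        (KyFan.ratio (KyFan.harmMean μ A B) (KyFan.arithMean μ A B)) ∧
      KyFan.IsOneAddCompactPos
        (KyFan.ratio (KyFan.geomMean μ (1 - A) (1 - B)) (KyFan.arithMean μ (1 - A) (1 - B))) ∧
      KyFan.IsOneAddCompactPos
        (KyFan.ratio (KyFan.harmMean μ (1 - A) (1 - B)) (KyFan.geomMean μ (1 - A) (1 - B))) ∧
      KyFan.IsOneAddCompactPos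
        (KyFan.ratio (KyFan.harmMean μ (1 - A) (1 - B)) (KyFan.arithMean μ (1 - A) (1 - B)))) ∧
    -- the three systems of eigenvalue inequalities
    (∀ j : ℕ, 1 ≤ j →
      KyFan.eigenvalue (KyFan.ratio (KyFan.geomMean μ (1 - A) (1 - B))
          (KyFan.arithMean μ (1 - A) (1 - B))) j ≤
        KyFan.eigenvalue (KyFan.ratio (KyFan.geomMean μ A B) (KyFan.arithMean μ A B)) j) ∧
    (∀ j : ℕ, 1 ≤ j →
      KyFan.eigenvalue (KyFan.ratio (KyFan.harmMean μ (1 - A) (1 - B))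
          (KyFan.geomMean μ (1 - A) (1 - B))) j ≤
        KyFan.eigenvalue (KyFan.ratio (KyFan.harmMean μ A B) (KyFan.geomMean μ A B)) j) ∧
    (∀ j : ℕ, 1 ≤ j →
      KyFan.eigenvalue (KyFan.ratio (KyFan.harmMean μ (1 - A) (1 - B))
          (KyFan.arithMean μ (1 - A) (1 - B))) j ≤
        KyFan.eigenvalue (KyFan.ratio (KyFan.harmMean μ A B) (KyFan.arithMean μ A B)) j) ∧
    -- the equality conditions
    (0 < μ → μ < 1 →
      ((∀ j : ℕ, 1 ≤ j →
        KyFan.eigenvalue (KyFan.ratio (KyFan.geomMean μ (1 - A) (1 - B))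
            (KyFan.arithMean μ (1 - A) (1 - B))) j =
          KyFan.eigenvalue (KyFan.ratio (KyFan.geomMean μ A B) (KyFan.arithMean μ A B)) j) ↔
        A = B) ∧
      ((∀ j : ℕ, 1 ≤ j →
        KyFan.eigenvalue (KyFan.ratio (KyFan.harmMean μ (1 - A) (1 - B))
            (KyFan.geomMean μ (1 - A) (1 - B))) j =
          KyFan.eigenvalue (KyFan.ratio (KyFan.harmMean μ A B) (KyFan.geomMean μ A B)) j) ↔
        A = B) ∧
      ((∀ j : ℕ, 1 ≤ j →
        KyFan.eigenvalue (KyFan.ratio (KyFan.harmMean μ (1 - A) (1 - B))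
            (KyFan.arithMean μ (1 - A) (1 - B))) j =
          KyFan.eigenvalue (KyFan.ratio (KyFan.harmMean μ A B) (KyFan.arithMean μ A B)) j) ↔
        A = B)) := by
  have hle : ∀ {A : H →L[ℂ] H}, A ≤ (1 / 2 : ℝ) • (1 : H →L[ℂ] H) → A ≤ 1 - A := by
    intro A h
    rw [le_sub_iff_add_le]
    calc A + A ≤ (1 / 2 : ℝ) • (1 : H →L[ℂ] H) + (1 / 2 : ℝ) • (1 : H →L[ℂ] H) := add_le_add h h
      _ = 1 := by rw [← add_smul]; norm_num
  have hA1 := hle hA'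
  have hB1 := hle hB'
  have hAp := hA.of_le hA1
  have hBp := hB.of_le hB1
  have hd : (1 - B) - (1 - A) = A - B := by abel
  have hc : IsCompactOperator (B - A : H →L[ℂ] H) := by simpa using hAB.neg
  have hc' : IsCompactOperator ((1 - B) - (1 - A) : H →L[ℂ] H) := by rw [hd]; exact hAB
  have p1 := KyFan.isMeanPair_geomMean_arithMean hμ₀ hμ₁ hA hB hc
  have p2 := KyFan.isMeanPair_harmMean_geomMean hμ₀ hμ₁ hA hB hc
  have p3 := KyFan.isMeanPair_harmMean_arithMean hμ₀ hμ₁ hA hB hc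
  have q1 := KyFan.isMeanPair_geomMean_arithMean hμ₀ hμ₁ hAp hBp hc'
  have q2 := KyFan.isMeanPair_harmMean_geomMean hμ₀ hμ₁ hAp hBp hc'
  have q3 := KyFan.isMeanPair_harmMean_arithMean hμ₀ hμ₁ hAp hBp hc'
  have f1 := KyFan.isKyFanFunction_arithGeomRatio hμ₀ hμ₁
  have f2 := KyFan.isKyFanFunction_arithGeomRatio_inv hμ₀ hμ₁
  have f3 := f1.mul f2
  have f2i : KyFan.IsKyFanFunction fun x => KyFan.arithGeomRatio μ x⁻¹⁻¹ := by
    simpa only [inv_inv] using f1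
  have f3i : KyFan.IsKyFanFunction
      fun x => KyFan.arithGeomRatio μ x⁻¹ * KyFan.arithGeomRatio μ x⁻¹⁻¹ := f2.mul f2i
  refine ⟨⟨p1.isOneAddCompactPos hA hB hc fun x hx => f1.one_le hx,
    p2.isOneAddCompactPos hA hB hc fun x hx => f2.one_le hx,
    p3.isOneAddCompactPos hA hB hc fun x hx => f3.one_le hx,
    q1.isOneAddCompactPos hAp hBp hc' fun x hx => f1.one_le hx,
    q2.isOneAddCompactPos hAp hBp hc' fun x hx => f2.one_le hx,
    q3.isOneAddCompactPos hAp hBp hc' fun x hx => f3.one_le hx⟩,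
    fun j hj => KyFan.eigenvalue_ratio_le f1 f2 hA hB hc hA1 hB1 hd p1 q1 hj,
    fun j hj => KyFan.eigenvalue_ratio_le f2 f2i hA hB hc hA1 hB1 hd p2 q2 hj,
    fun j hj => KyFan.eigenvalue_ratio_le f3 f3i hA hB hc hA1 hB1 hd p3 q3 hj,
    fun h0 h1 => ?_⟩
  have n1 : ∀ x, 0 < x → x ≠ 1 → 1 < KyFan.arithGeomRatio μ x := fun x =>
    KyFan.one_lt_arithGeomRatio h0 h1
  have n2 : ∀ x, 0 < x → x ≠ 1 → 1 < KyFan.arithGeomRatio μ x⁻¹ := fun x hx hx1 =>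
    n1 _ (inv_pos.2 hx) (by simpa using hx1)
  have s1 : ∀ s, 0 < s → s < 1 → KyFan.arithGeomRatio μ (1 + s) < KyFan.arithGeomRatio μ (1 - s) :=
    fun s => KyFan.arithGeomRatio_reflect_lt h0 h1
  have s2 : ∀ s, 0 < s → s < 1 →
      KyFan.arithGeomRatio μ (1 + s)⁻¹ < KyFan.arithGeomRatio μ (1 - s)⁻¹ :=
    fun s => KyFan.arithGeomRatio_inv_reflect_lt h0 h1
  have s3 : ∀ s, 0 < s → s < 1 →
      KyFan.arithGeomRatio μ (1 + s) * KyFan.arithGeomRatio μ (1 + s)⁻¹ <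
        KyFan.arithGeomRatio μ (1 - s) * KyFan.arithGeomRatio μ (1 - s)⁻¹ := fun s hs0 hs1 =>
    mul_lt_mul'' (s1 s hs0 hs1) (s2 s hs0 hs1)
      (zero_le_one.trans (f1.one_le (by linarith))) (zero_le_one.trans (f2.one_le (by linarith)))
  refine ⟨KyFan.forall_eigenvalue_eq_iff f1 f2 n1 s1 s2 hA hB hc hA1 hB1 p1 q1,
    KyFan.forall_eigenvalue_eq_iff f2 f2i n2 s2 (by simpa only [inv_inv] using s1) hA hB hc hA1 hB1
      p2 q2,
    KyFan.forall_eigenvalue_eq_iff f3 f3i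
      (fun x hx hx1 => one_lt_mul_of_lt_of_le (n1 x hx hx1) (n2 x hx hx1).le) s3
      (fun s hs0 hs1 => ?_) hA hB hc hA1 hB1 p3 q3⟩
  simpa only [inv_inv, mul_comm] using s3 s hs0 hs1
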